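/- **Prioritized programs.** A classical literal is an atom $a$ or its classical negation $\neg a$. A prioritized propositional program is a pair $\mathcal P=(P,<)$, where $P$ is a finite set of propositional rules $r$ of the form $c \mathrel{:-} a_1,\dots,a_m,\ \mathrm{not}\ b_1,\dots,\mathrm{not}\ b_k$ with exactly one head literal ($H(r)=\{c\}$, $B^+(r)=\{a_1,\dots,a_m\}$, $B^-(r)=\{b_1,\dots,b_k\}$, all classical literals), and $<$ is a strict partial order on $P$; $r<r'$ means that $r$ has higher priority. Let $B_P$ be the set of all classical literals over the atoms occurring in $P$, and let $n=|P|$. A set of literals is consistent if it contains no two complementary literals. **W-preferred answer sets.** A rule $r$ is active w.r.t. $(X,Y)$ if $B^+(r)\subseteq X$ and $B^-(r)\cap Y=\emptyset$. For $S\subseteq B_P$ put $S_0=\emptyset$ and, for $i=1,\dots,n$, let $S_i$ be the union of $S_{i-1}$ with the heads of all $r\in P$ such that $r$ is active w.r.t. $(S_{i-1},S)$ and there is no $r'\in P$ with $r'<r$ that is active w.r.t. $(S,S_{i-1})$ and whose head is not in $S_{i-1}$. Let $C^W_{\mathcal P}(S)=S_n$ if $S_n$ is consistent, and $C^W_{\mathcal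 P}(S)=B_P$ otherwise. Let $\mathcal{WPAS}(\mathcal P)$ be the set of all consistent $S\subseteq B_P$ with $C^W_{\mathcal P}(S)=S$. **Answer sets.** The answer sets $\mathcal{AS}(Q)$ of a function-free disjunctive program $Q$ are those of its ground instantiation over its Herbrand universe (the constants of $Q$, or one arbitrary constant if there are none), where instances with a false comparison $s>t$ are dropped and true comparisons are deleted. Here $>$ refers to a fixed, arbitrary total order on constants. A set $I$ of ground literals is an answer set of a ground program if it is minimal, w.r.t. inclusion, among the consistent sets of literals from the Herbrand base that are closed under the Gelfond–Lifschitz reduct w.r.t. $I$. **Representation of $\mathcal P$.** Literals are represented by pairwise distinct constants and rules by pairwise distinct identifiers. $F(\mathcal P)$ consists of the facts $rule(r)$, $head(c,r)$ for $c\in H(r)$, $pbl(a,r)$ for $a\in B^+(r)$, $nbl(b,r)$ for $b\in B^-(r)$, for all $r\in P$; $compl(a,\neg a)$ for each atom $a$ such that $a$ and $\neg a$ both occur in $P$; and $pr(r,r')$ for all pairs $r<r'$ in the transitive reduction of $<$. **The meta-interpreter.** $P_{I_W}$ is the following program, which does not depend on $\mathcal P$ ($\_$ is an anonymous variable): - $lit(L)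 \mathrel{:-} head(L,\_)$; $\quad lit(L) \mathrel{:-} pbl(L,\_)$; $\quad lit(L) \mathrel{:-} nbl(L,\_)$; - $in\_S(L) \vee notin\_S(L) \mathrel{:-} lit(L)$; $\quad \mathrel{:-} compl(X,Y), in\_S(X), in\_S(Y)$; - $pr(X,Z) \mathrel{:-} pr(X,Y), pr(Y,Z)$; $\quad \mathrel{:-} pr(X,X)$; $\quad stage(S) \mathrel{:-} rule(S)$; - $pos\_body\_false\_S(Y) \mathrel{:-} rule(Y), pbl(X,Y), \mathrm{not}\ in\_S(X)$; - $pos\_body\_false\_Si(R,Si) \mathrel{:-} pbl(L,R), stage(Si), \mathrm{not}\ in\_Si(L,Si)$; - $pos\_body\_false\_S0(R) \mathrel{:-} pbl(L,R)$; - $neg\_body\_false\_S(Y) \mathrel{:-} rule(Y), nbl(X,Y), in\_S(X)$; - $neg\_body\_false\_Si(R,Si) \mathrel{:-} nbl(L,R), stage(Si), in\_Si(L,Si)$; - $active(R,Si) \mathrel{:-} rule(R), stage(Si), \mathrm{not}\ pos\_body\_false\_Si(R,Si), \mathrm{not}\ neg\_body\_false\_S(R)$; - $active\_Si(R,Si)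 \mathrel{:-} rule(R), stage(Si), \mathrm{not}\ pos\_body\_false\_S(R), \mathrm{not}\ neg\_body\_false\_Si(R,Si)$; - $active\_S0(R) \mathrel{:-} rule(R), \mathrm{not}\ pos\_body\_false\_S0(R), \mathrm{not}\ neg\_body\_false\_S(R)$; - $head\_not\_in\_Si(R,Si) \mathrel{:-} stage(Si), head(H,R), \mathrm{not}\ in\_Si(H,Si)$; - $preferred\_generating\_rule\_exists(R,Si) \mathrel{:-} pr(R1,R), active\_Si(R1,Si), head\_not\_in\_Si(R1,Si)$; - $preferred\_generating\_rule\_exists\_S0(R) \mathrel{:-} pr(R1,R), \mathrm{not}\ pos\_body\_false\_S(R1)$; - $in\_Si(H,Si) \mathrel{:-} head(H,R), active(R,Sj), stage(Sj), stage(Si), Si > Sj, \mathrm{not}\ preferred\_generating\_rule\_exists(R,Sj)$; - $in\_Si(H,Si) \mathrel{:-} head(H,R), active\_S0(R), stage(Si), \mathrm{not}\ preferred\_generating\_rule\_exists\_S0(R)$; - $in\_PAS(L) \mathrel{:-} in\_Si(L,\_)$; $\quad \mathrel{:-} in\_PAS(L), \mathrm{not}\ in\_S(L)$; $\quad \mathrel{:-}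 in\_S(L), \mathrm{not}\ in\_PAS(L)$. **Theorem.** Let $\mathcal P=(P,<)$ be a propositional prioritized program, and for a set $A$ of ground literals let $\pi'(A)=\{\ell \mid in\_PAS(\ell)\in A\}$. Then (i) if $A\in\mathcal{AS}(P_{I_W}\cup F(\mathcal P))$, then $\pi'(A)\in\mathcal{WPAS}(\mathcal P)$; and (ii) for each $A\in\mathcal{WPAS}(\mathcal P)$ there exists some $A'\in\mathcal{AS}(P_{I_W}\cup F(\mathcal P))$ such that $\pi'(A')=A$. -/

import Mathlib

namespace ASP

/-! ## Classical literals, ground rules, answer sets -/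

/-- Classical literals over a type of atoms: `a` or `¬ a`. -/
inductive Literal (A : Type*) where
  | pos (a : A) : Literal A
  | neg (a : A) : Literal A

namespace Literal

variable {A : Type*}

/-- The atom of a literal. -/
def atom : Literal A → A
  | pos a => a
  | neg a => a

/-- The complementary literal. -/
def compl : Literal A → Literal A
  | pos a => neg a
  | neg a => pos a

/-- Renaming of atoms. -/
def map {B : Type*} (f : A → B) : Literal A → Literal B
  | pos a => pos (f a)
  | neg a => neg (f a)

end Literal

/-- A set of literals is consistent if it contains no two complementary literals. -/
def Consistent {A : Type*} (I : Set (Literal A)) : Prop :=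
  I ∩ Literal.compl '' I = ∅

/-- A variable-free rule
`a₁ v … v aₙ :- b₁, …, b_k, not b_{k+1}, …, not b_m`, given by the lists
`a₁ … aₙ`, `b₁ … b_k` and `b_{k+1} … b_m` of classical literals. -/
structure Rule (A : Type*) where
  head : List (Literal A)
  pos : List (Literal A)
  neg : List (Literal A)

namespace Rule

variable {A : Type*}

/-- `H(r)`. -/
def H (r : Rule A) : Set (Literal A) := {l | l ∈ r.head}

/-- `B⁺(r)`. -/
def Bpos (r : Rule A) : Set (Literal A) := {l | l ∈ r.pos}

/-- `B⁻(r)`. -/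
def Bneg (r : Rule A) : Set (Literal A) := {l | l ∈ r.neg}

/-- The literals that occur in a rule. -/
def lits (r : Rule A) : Set (Literal A) := r.H ∪ r.Bpos ∪ r.Bneg

end Rule

/-- `I` is closed under the `not`-free ground program `P`. -/
def ClosedUnder {A : Type*} (P : Set (Rule A)) (I : Set (Literal A)) : Prop :=
  ∀ r ∈ P, r.Bpos ⊆ I → (r.H ∩ I).Nonempty

/-- The Gelfond-Lifschitz reduct of a ground program. -/
def reduct {A : Type*} (P : Set (Rule A)) (I : Set (Literal A)) : Set (Rule A) :=
  {q | ∃ r ∈ P, r.Bneg ∩ I = ∅ ∧ q = ⟨r.head, r.pos, []⟩}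

/-- `I` is a (consistent) answer set of the ground program `P` over the base `B` of literals:
`I` is minimal among the consistent subsets of `B` that are closed under the reduct `P^I`. -/
def IsAnswerSet {A : Type*} (B : Set (Literal A)) (P : Set (Rule A)) (I : Set (Literal A)) :
    Prop :=
  Minimal (fun J : Set (Literal A) => J ⊆ B ∧ Consistent J ∧ ClosedUnder (reduct P I) J) I

/-! ## Programs with variables (function-free) -/

/-- Terms: variables from `V` and constants from `C`. -/
inductive Term (V C : Type*) where
  | var (x : V) : Term V C
  | const (c : C) : Term V C

/-- The value of a term under an assignment of constants to the variables. -/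
def Term.inst {V C : Type*} (θ : V → C) : Term V C → C
  | .var x => θ x
  | .const c => c

/-- Atoms `p(t₁, …, t_k)` over predicate names `p` from `Q`. -/
structure Atom (Q T : Type*) where
  pred : Q
  args : List T

/-- Substitution of terms. -/
def Atom.map {Q T T' : Type*} (f : T → T') (a : Atom Q T) : Atom Q T' :=
  ⟨a.pred, a.args.map f⟩

/-- Rules with variables. Besides positive and default-negated classical literals the body has
comparisons `s > t` with respect to the built-in total order on constants, each given as the pair
`(s, t)` in the list `gt`. -/
structure VRule (Q V C : Type*) where
  head : List (Literal (Atom Q (Term V C)))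
  pos : List (Literal (Atom Q (Term V C)))
  neg : List (Literal (Atom Q (Term V C)))
  gt : List (Term V C × Term V C)

namespace VRule

variable {Q V C : Type*}

/-- The (ordinary) atoms that occur in a rule. -/
def atoms (r : VRule Q V C) : Set (Atom Q (Term V C)) :=
  {a | ∃ l ∈ r.head ++ r.pos ++ r.neg, l.atom = a}

/-- The constants that occur in a rule. -/
def consts (r : VRule Q V C) : Set C :=
  {c | (∃ a ∈ r.atoms, Term.const c ∈ a.args) ∨
    ∃ p ∈ r.gt, p.1 = Term.const c ∨ p.2 = Term.const c}

/-- The ground instance of a rule under an assignment, without its built-in comparisons. -/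
def inst (θ : V → C) (r : VRule Q V C) : Rule (Atom Q C) where
  head := r.head.map (Literal.map (Atom.map (Term.inst θ)))
  pos := r.pos.map (Literal.map (Atom.map (Term.inst θ)))
  neg := r.neg.map (Literal.map (Atom.map (Term.inst θ)))

/-- The built-in comparisons of the rule are true under the assignment. -/
def CmpTrue [LinearOrder C] (θ : V → C) (r : VRule Q V C) : Prop :=
  ∀ p ∈ r.gt, p.1.inst θ > p.2.inst θ

end VRule

section Programs

variable {Q V C : Type*}

open Classical in
/-- The Herbrand universe: the constants that occur in the program, or one arbitrary constant if
there are none. -/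
noncomputable def herbrandUniverse [Inhabited C] (P : Set (VRule Q V C)) : Set C :=
  if (⋃ r ∈ P, r.consts) = ∅ then {default} else ⋃ r ∈ P, r.consts

/-- The Herbrand base: all ground classical literals built from the predicate symbols (names with
their number of arguments) of the program and the constants of the Herbrand universe. -/
def herbrandBase [Inhabited C] (P : Set (VRule Q V C)) : Set (Literal (Atom Q C)) :=
  {l | (∃ r ∈ P, ∃ a ∈ r.atoms,
      a.pred = l.atom.pred ∧ a.args.length = l.atom.args.length) ∧
    ∀ c ∈ l.atom.args, c ∈ herbrandUniverse P}

/-- The ground instantiation over the Herbrand universe. Instances with a false built-in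
comparison are dropped, true comparisons are deleted. -/
def ground [Inhabited C] [LinearOrder C] (P : Set (VRule Q V C)) : Set (Rule (Atom Q C)) :=
  {q | ∃ r ∈ P, ∃ θ : V → C, (∀ x, θ x ∈ herbrandUniverse P) ∧ r.CmpTrue θ ∧ q = r.inst θ}

/-- The set of all (consistent) answer sets of a program with variables. -/
def answerSets [Inhabited C] [LinearOrder C] (P : Set (VRule Q V C)) :
    Set (Set (Literal (Atom Q C))) :=
  {I | IsAnswerSet (herbrandBase P) (ground P) I}

end Programs

/-! ## Prioritized propositional programs and W-preferred answer sets -/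

/-- A prioritized propositional program: a finite set of rules, each with exactly one head
literal, and a strict partial order on this set; `lt r r'` means that `r` has higher priority. -/
structure PrioritizedProgram (α : Type*) where
  rules : Finset (Rule α)
  normal : ∀ r ∈ rules, ∃ h, r.head = [h]
  lt : Rule α → Rule α → Prop
  irrefl : ∀ r ∈ rules, ¬ lt r r
  trans : ∀ r₁ ∈ rules, ∀ r₂ ∈ rules, ∀ r₃ ∈ rules, lt r₁ r₂ → lt r₂ r₃ → lt r₁ r₃

namespace PrioritizedProgram

variable {α : Type*} (P : PrioritizedProgram α)

/-- The literals that occur in the program. -/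
def lits : Set (Literal α) := {l | ∃ r ∈ P.rules, l ∈ r.lits}

/-- The base `B_P`: all literals over the atoms that occur in the program. -/
def base : Set (Literal α) := {l | ∃ l' ∈ P.lits, l'.atom = l.atom}

end PrioritizedProgram

/-- A rule is active with respect to `(X, Y)`. -/
def Rule.Active {α : Type*} (r : Rule α) (X Y : Set (Literal α)) : Prop :=
  r.Bpos ⊆ X ∧ r.Bneg ∩ Y = ∅

namespace PrioritizedProgram

variable {α : Type*} (P : PrioritizedProgram α)

/-- One step of the construction: the heads of the rules `r` that are active with respect to
`(T, S)` and for which no rule `r' < r` is active with respect to `(S, T)` and has its head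
outside `T`. -/
def stepW (S T : Set (Literal α)) : Set (Literal α) :=
  {h | ∃ r ∈ P.rules, h ∈ r.H ∧ r.Active T S ∧
    ¬ ∃ r' ∈ P.rules, P.lt r' r ∧ r'.Active S T ∧ ¬ r'.H ⊆ T}

/-- The sequence `S₀, S₁, …`. -/
def seqW (S : Set (Literal α)) : ℕ → Set (Literal α)
  | 0 => ∅
  | i + 1 => seqW S i ∪ P.stepW S (seqW S i)

open Classical in
/-- The operator `C^W_P`, where `n` is the number of rules. -/
noncomputable def CW (S : Set (Literal α)) : Set (Literal α) :=
  if Consistent (P.seqW S P.rules.card) then P.seqW S P.rules.card else P.base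

/-- The (consistent) W-preferred answer sets. -/
def WPAS : Set (Set (Literal α)) :=
  {S | S ⊆ P.base ∧ Consistent S ∧ P.CW S = S}

end PrioritizedProgram

/-! ## The meta-interpreter -/

/-- The predicate names of the meta-interpreter. -/
inductive MetaPred where
  | rule | head | pbl | nbl | compl | pr
  | lit | in_S | notin_S | stage
  | pos_body_false_S | pos_body_false_Si | pos_body_false_S0
  | neg_body_false_S | neg_body_false_Si
  | active | active_Si | active_S0
  | head_not_in_Si
  | preferred_generating_rule_exists | preferred_generating_rule_exists_S0
  | in_Si | in_PAS

/-- The variables of the meta-interpreter; `W` plays the role of the anonymous variable `_`. -/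
inductive MetaVar where
  | L | H | X | Y | Z | R | R1 | S | Si | Sj | W

/-- Unary atoms over variables. -/
def a1 {C : Type*} (p : MetaPred) (x : MetaVar) : Literal (Atom MetaPred (Term MetaVar C)) :=
  .pos ⟨p, [.var x]⟩

/-- Binary atoms over variables. -/
def a2 {C : Type*} (p : MetaPred) (x y : MetaVar) : Literal (Atom MetaPred (Term MetaVar C)) :=
  .pos ⟨p, [.var x, .var y]⟩

/-- The list of the rules of the meta-interpreter, each in the form
`⟨head, positive body, default-negated body, comparisons⟩`. -/
def metaRules (C : Type*) : List (VRule MetaPred MetaVar C) :=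
  [ ⟨[a1 .lit .L], [a2 .head .L .W], [], []⟩,
    ⟨[a1 .lit .L], [a2 .pbl .L .W], [], []⟩,
    ⟨[a1 .lit .L], [a2 .nbl .L .W], [], []⟩,
    ⟨[a1 .in_S .L, a1 .notin_S .L], [a1 .lit .L], [], []⟩,
    ⟨[], [a2 .compl .X .Y, a1 .in_S .X, a1 .in_S .Y], [], []⟩,
    ⟨[a2 .pr .X .Z], [a2 .pr .X .Y, a2 .pr .Y .Z], [], []⟩,
    ⟨[], [a2 .pr .X .X], [], []⟩,
    ⟨[a1 .stage .S], [a1 .rule .S], [], []⟩,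
    ⟨[a1 .pos_body_false_S .Y], [a1 .rule .Y, a2 .pbl .X .Y], [a1 .in_S .X], []⟩,
    ⟨[a2 .pos_body_false_Si .R .Si], [a2 .pbl .L .R, a1 .stage .Si], [a2 .in_Si .L .Si], []⟩,
    ⟨[a1 .pos_body_false_S0 .R], [a2 .pbl .L .R], [], []⟩,
    ⟨[a1 .neg_body_false_S .Y], [a1 .rule .Y, a2 .nbl .X .Y, a1 .in_S .X], [], []⟩,
    ⟨[a2 .neg_body_false_Si .R .Si], [a2 .nbl .L .R, a1 .stage .Si, a2 .in_Si .L .Si], [], []⟩,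
    ⟨[a2 .active .R .Si], [a1 .rule .R, a1 .stage .Si],
      [a2 .pos_body_false_Si .R .Si, a1 .neg_body_false_S .R], []⟩,
    ⟨[a2 .active_Si .R .Si], [a1 .rule .R, a1 .stage .Si],
      [a1 .pos_body_false_S .R, a2 .neg_body_false_Si .R .Si], []⟩,
    ⟨[a1 .active_S0 .R], [a1 .rule .R],
      [a1 .pos_body_false_S0 .R, a1 .neg_body_false_S .R], []⟩,
    ⟨[a2 .head_not_in_Si .R .Si], [a1 .stage .Si, a2 .head .H .R], [a2 .in_Si .H .Si], []⟩,
    ⟨[a2 .preferred_generating_rule_exists .R .Si],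
      [a2 .pr .R1 .R, a2 .active_Si .R1 .Si, a2 .head_not_in_Si .R1 .Si], [], []⟩,
    ⟨[a1 .preferred_generating_rule_exists_S0 .R],
      [a2 .pr .R1 .R], [a1 .pos_body_false_S .R1], []⟩,
    ⟨[a2 .in_Si .H .Si],
      [a2 .head .H .R, a2 .active .R .Sj, a1 .stage .Sj, a1 .stage .Si],
      [a2 .preferred_generating_rule_exists .R .Sj], [(.var .Si, .var .Sj)]⟩,
    ⟨[a2 .in_Si .H .Si], [a2 .head .H .R, a1 .active_S0 .R, a1 .stage .Si],
      [a1 .preferred_generating_rule_exists_S0 .R], []⟩,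
    ⟨[a1 .in_PAS .L], [a2 .in_Si .L .W], [], []⟩,
    ⟨[], [a1 .in_PAS .L], [a1 .in_S .L], []⟩,
    ⟨[], [a1 .in_S .L], [a1 .in_PAS .L], []⟩ ]

/-- The meta-interpreter `P_{I_W}` as a program. -/
def metaW (C : Type*) : Set (VRule MetaPred MetaVar C) := {r | r ∈ metaRules C}

/-- The fact `p(c₁, …, c_k).` -/
def fact {C : Type*} (p : MetaPred) (cs : List C) : VRule MetaPred MetaVar C :=
  ⟨[.pos ⟨p, cs.map .const⟩], [], [], []⟩

/-- The representation `F(P)` of a prioritized program by facts, where `litName l` is the constant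
that represents the literal `l`, and `ruleId r` is the identifier of the rule `r`. The facts for
`pr` come from the transitive reduction of the order. -/
def facts {α C : Type*} (litName : Literal α → C) (ruleId : Rule α → C)
    (P : PrioritizedProgram α) : Set (VRule MetaPred MetaVar C) :=
  {f | ∃ r ∈ P.rules, f = fact .rule [ruleId r]} ∪
  {f | ∃ r ∈ P.rules, ∃ l ∈ r.H, f = fact .head [litName l, ruleId r]} ∪
  {f | ∃ r ∈ P.rules, ∃ l ∈ r.Bpos, f = fact .pbl [litName l, ruleId r]} ∪
  {f | ∃ r ∈ P.rules, ∃ l ∈ r.Bneg, f = fact .nbl [litName l, ruleId r]} ∪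
  {f | ∃ a : α, Literal.pos a ∈ P.lits ∧ Literal.neg a ∈ P.lits ∧
    f = fact .compl [litName (.pos a), litName (.neg a)]} ∪
  {f | ∃ r ∈ P.rules, ∃ r' ∈ P.rules, P.lt r r' ∧
    (¬ ∃ r'' ∈ P.rules, P.lt r r'' ∧ P.lt r'' r') ∧
    f = fact .pr [ruleId r, ruleId r']}

/-- The projection `π'(A) = {l | in_PAS(l) ∈ A}`. -/
def projPAS {α C : Type*} (litName : Literal α → C) (A : Set (Literal (Atom MetaPred C))) :
    Set (Literal α) :=
  {l | Literal.pos ⟨.in_PAS, [litName l]⟩ ∈ A}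

end ASP

/-! The stages `S₁, …, Sₙ` are named by the `n` rule identifiers: the `k`-th smallest identifier in
the order on constants names `S_k`. Since `S_i` is the union of the one-step consequences taken at
all earlier stages, the recursion for `in_Si`, which refers to every smaller identifier, together
with the separate predicates for stage 0, computes `P.seqW S` for the guessed `S`. The two
constraints linking `in_PAS` with `in_S` then express `Sₙ = S`.

`closedUnder_reduct_meta_iff` turns closure under the reduct into closure under `MetaStep` and
`MetaGuess`. For soundness, closure and support together characterise each auxiliary predicate in an
answer set; only the transitive `pr`, a positive recursion, needs a genuine induction using
minimality. Negation involving `in_Si` always passes to a smaller identifier, so the stages are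
determined by induction (`projPAS_mem_WPAS`).

For completeness, the extensions dictated by a fixed point `S` form the explicit set `metaModelSet`.
It is closed, and any closed subset of it is the whole set: the subset must make the same guess at
`in_S`, and everything else is then derived (`metaModelSet_subset_of_closed`). -/

namespace ASP

/-! ## Ground programs: closure and support -/

section General

variable {Q V C : Type*}

/-- The ground instance of a literal. -/
def instLit (θ : V → C) : Literal (Atom Q (Term V C)) → Literal (Atom Q C) :=
  Literal.map (Atom.map (Term.inst θ))

theorem closedUnder_reduct_ground_iff [Inhabited C] [LinearOrder C] {P : Set (VRule Q V C)}
    {I J : Set (Literal (Atom Q C))} :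
    ClosedUnder (reduct (ground P) I) J ↔
      ∀ r ∈ P, ∀ θ : V → C, (∀ x, θ x ∈ herbrandUniverse P) → r.CmpTrue θ →
        (∀ l ∈ r.neg, instLit θ l ∉ I) → (∀ l ∈ r.pos, instLit θ l ∈ J) →
        ∃ l ∈ r.head, instLit θ l ∈ J := by
  constructor
  · intro h r hr θ hθ hc hn hp
    obtain ⟨l, hl, hlJ⟩ := h ⟨(r.inst θ).head, (r.inst θ).pos, []⟩
      ⟨r.inst θ, ⟨r, hr, θ, hθ, hc, rfl⟩, by
        ext l
        simp only [Set.mem_inter_iff, Set.mem_empty_iff_false, iff_false, not_and]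
        intro hl
        obtain ⟨l', hl', rfl⟩ := List.mem_map.1 hl
        exact hn l' hl', rfl⟩ (by
        intro l hl
        obtain ⟨l', hl', rfl⟩ := List.mem_map.1 hl
        exact hp l' hl')
    obtain ⟨l', hl', rfl⟩ := List.mem_map.1 hl
    exact ⟨l', hl', hlJ⟩
  · rintro h _ ⟨_, ⟨r, hr, θ, hθ, hc, rfl⟩, hn, rfl⟩ hp
    obtain ⟨l, hl, hlJ⟩ := h r hr θ hθ hc
      (fun l hl hI => Set.eq_empty_iff_forall_notMem.1 hn _ ⟨List.mem_map_of_mem hl, hI⟩)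
      (fun l hl => hp (List.mem_map_of_mem hl))
    exact ⟨_, List.mem_map_of_mem hl, hlJ⟩

/-- Induction over an answer set: a property that is inherited by the heads of all applicable
rules whose positive bodies have it holds on the whole answer set. -/
theorem answerSets_induction [Inhabited C] [LinearOrder C] {P : Set (VRule Q V C)}
    {A : Set (Literal (Atom Q C))} (hA : A ∈ answerSets P) (p : Literal (Atom Q C) → Prop)
    (h : ∀ r ∈ P, ∀ θ : V → C, (∀ x, θ x ∈ herbrandUniverse P) → r.CmpTrue θ →
        (∀ l ∈ r.neg, instLit θ l ∉ A) → (∀ l ∈ r.pos, instLit θ l ∈ A ∧ p (instLit θ l)) →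
        ∀ l ∈ r.head, p (instLit θ l)) :
    ∀ l ∈ A, p l := by
  obtain ⟨⟨hB, hcons, hcl⟩, hmin⟩ := hA
  -- The part of `A` satisfying `p` is closed under the same reduct, taken with respect to `A`, so
  -- minimality makes it all of `A`. Since `p` is inherited by every head literal, it does not
  -- matter which disjunct `A` contains.
  have hsub : {l ∈ A | p l} ⊆ A := fun l hl => hl.1
  refine fun l hl => (hmin (y := {l ∈ A | p l}) ⟨hsub.trans hB, ?_, ?_⟩ hsub hl).2
  · exact Set.subset_eq_empty (Set.inter_subset_inter hsub (Set.image_mono hsub)) hcons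
  · rw [closedUnder_reduct_ground_iff] at hcl ⊢
    intro r hr θ hθ hc hn hp
    obtain ⟨l, hl, hlA⟩ := hcl r hr θ hθ hc hn fun l hl => (hp l hl).1
    exact ⟨l, hl, hlA, h r hr θ hθ hc hn hp l hl⟩

/-- Every literal of an answer set is supported by an applicable rule. -/
theorem answerSets_supported [Inhabited C] [LinearOrder C] {P : Set (VRule Q V C)}
    {A : Set (Literal (Atom Q C))} (hA : A ∈ answerSets P) :
    ∀ l ∈ A, ∃ r ∈ P, ∃ θ : V → C, r.CmpTrue θ ∧ (∀ l ∈ r.neg, instLit θ l ∉ A) ∧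
      (∀ l ∈ r.pos, instLit θ l ∈ A) ∧ ∃ l' ∈ r.head, instLit θ l' = l :=
  answerSets_induction hA _ fun r hr θ _ hc hn hp l hl =>
    ⟨r, hr, θ, hc, hn, fun l hl => (hp l hl).1, l, hl, rfl⟩

theorem mem_herbrandUniverse [Inhabited C] {P : Set (VRule Q V C)} {r : VRule Q V C} {c : C}
    (hr : r ∈ P) (hc : c ∈ r.consts) : c ∈ herbrandUniverse P := by
  have h : c ∈ ⋃ r ∈ P, r.consts := Set.mem_biUnion hr hc
  rw [herbrandUniverse, if_neg (Set.nonempty_iff_ne_empty.1 ⟨c, h⟩)]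
  exact h

theorem herbrandUniverse_nonempty [Inhabited C] (P : Set (VRule Q V C)) :
    (herbrandUniverse P).Nonempty := by
  rw [herbrandUniverse]
  split
  · exact Set.singleton_nonempty _
  · exact Set.nonempty_iff_ne_empty.2 ‹_›

end General

/-! ## The construction of W-preferred answer sets -/

section Stages

variable {α C : Type*} [LinearOrder C] {P : PrioritizedProgram α} {ruleId : Rule α → C}

/-- Unrolling the cumulative union makes all earlier stages visible at once, which is the shape of
the `in_Si` rule with its condition `Si > Sj`. -/
theorem mem_seqW_iff {S : Set (Literal α)} {l : Literal α} {i : ℕ} :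
    l ∈ P.seqW S i ↔ ∃ j < i, l ∈ P.stepW S (P.seqW S j) := by
  induction i with
  | zero => simp [PrioritizedProgram.seqW]
  | succ i ih =>
    rw [PrioritizedProgram.seqW, Set.mem_union, ih]
    simp only [Nat.lt_succ_iff_lt_or_eq, or_and_right, exists_or, exists_eq_left]

theorem stepW_subset_lits {S T : Set (Literal α)} : P.stepW S T ⊆ P.lits := by
  rintro l ⟨r, hr, hl, -⟩
  exact ⟨r, hr, Or.inl (Or.inl hl)⟩

theorem seqW_subset_lits {S : Set (Literal α)} {i : ℕ} : P.seqW S i ⊆ P.lits := fun l hl => by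
  obtain ⟨j, -, h⟩ := mem_seqW_iff.1 hl
  exact stepW_subset_lits h

theorem lits_subset_base : P.lits ⊆ P.base := fun l hl => ⟨l, hl, rfl⟩

/-- The index of the stage that is named by a constant. -/
def stageIndex (P : PrioritizedProgram α) (ruleId : Rule α → C) (c : C) : ℕ :=
  (P.rules.filter fun r => ruleId r ≤ c).card

theorem stageIndex_mono : Monotone (stageIndex P ruleId) := fun _ _ h =>
  Finset.card_le_card (Finset.monotone_filter_right _ fun _ _ h' => h'.trans h)

/-- A rule `s` is counted at its own identifier but at no smaller one, so the index grows strictly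
there. -/
theorem stageIndex_lt_iff {r s : Rule α} (hs : s ∈ P.rules) :
    stageIndex P ruleId (ruleId r) < stageIndex P ruleId (ruleId s) ↔ ruleId r < ruleId s := by
  refine ⟨stageIndex_mono.reflect_lt, fun h => Finset.card_lt_card ?_⟩
  refine Finset.ssubset_iff_subset_ne.2
    ⟨Finset.monotone_filter_right _ fun _ _ h' => h'.trans h.le, fun he => ?_⟩
  have : s ∈ P.rules.filter fun r' => ruleId r' ≤ ruleId r := he ▸ by simp [hs]
  exact absurd (Finset.mem_filter.1 this).2 (not_le.2 h)

theorem stageIndex_pos {r : Rule α} (hr : r ∈ P.rules) :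
    0 < stageIndex P ruleId (ruleId r) :=
  Finset.card_pos.2 ⟨r, by simp [hr]⟩

theorem stageIndex_le_card (c : C) : stageIndex P ruleId c ≤ P.rules.card :=
  Finset.card_le_card (Finset.filter_subset _ _)

/-- The index maps the `n` rules injectively into `{1, …, n}`, hence onto it. Stage 0 has no name,
which is why the program treats it by separate predicates. -/
theorem exists_stageIndex_eq (hid : Set.InjOn ruleId {r | r ∈ P.rules}) {j : ℕ} (h0 : 0 < j)
    (hj : j ≤ P.rules.card) : ∃ r ∈ P.rules, stageIndex P ruleId (ruleId r) = j := by
  have := Finset.surjOn_of_injOn_of_card_le (s := P.rules) (t := Finset.Icc 1 P.rules.card)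
    (fun r => stageIndex P ruleId (ruleId r))
    (fun r hr => by
      have := stageIndex_pos (ruleId := ruleId) hr
      simpa [stageIndex_le_card, Nat.one_le_iff_ne_zero, pos_iff_ne_zero] using this)
    (fun r hr s hs h => by
      refine hid hr hs (le_antisymm ?_ ?_)
      · exact not_lt.1 fun h' => h.not_gt ((stageIndex_lt_iff hr).2 h')
      · exact not_lt.1 fun h' => h.not_lt ((stageIndex_lt_iff hs).2 h'))
    (by simp)
  exact this (by simp; omega)

/-- The two alternatives mirror the two rules for `in_Si`: a contribution from `S₀ = ∅`, or one from
a named earlier stage. -/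
theorem mem_seqW_stageIndex_iff (hid : Set.InjOn ruleId {r | r ∈ P.rules})
    {S : Set (Literal α)} {l : Literal α} {s : Rule α} (hs : s ∈ P.rules) :
    l ∈ P.seqW S (stageIndex P ruleId (ruleId s)) ↔
      l ∈ P.stepW S ∅ ∨ ∃ s' ∈ P.rules, ruleId s' < ruleId s ∧
        l ∈ P.stepW S (P.seqW S (stageIndex P ruleId (ruleId s'))) := by
  rw [mem_seqW_iff]
  constructor
  · rintro ⟨j, hj, hl⟩
    rcases Nat.eq_zero_or_pos j with rfl | h0
    · exact Or.inl hl
    · obtain ⟨s', hs', rfl⟩ := exists_stageIndex_eq hid h0 (hj.le.trans (stageIndex_le_card _))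
      exact Or.inr ⟨s', hs', (stageIndex_lt_iff hs).1 hj, hl⟩
  · rintro (h | ⟨s', hs', hlt, h⟩)
    · exact ⟨0, stageIndex_pos hs, h⟩
    · exact ⟨_, (stageIndex_lt_iff hs).2 hlt, h⟩

theorem mem_seqW_card_iff (hid : Set.InjOn ruleId {r | r ∈ P.rules})
    {S : Set (Literal α)} {l : Literal α} :
    l ∈ P.seqW S P.rules.card ↔
      ∃ s ∈ P.rules, l ∈ P.seqW S (stageIndex P ruleId (ruleId s)) := by
  constructor
  · intro h
    -- Membership provides some `j < n`, so `n > 0` and the last stage has a name; without rules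
    -- both sides are empty.
    obtain ⟨j, hj, -⟩ := mem_seqW_iff.1 h
    obtain ⟨s, hs, he⟩ := exists_stageIndex_eq hid (Nat.zero_lt_of_lt hj) le_rfl
    exact ⟨s, hs, he ▸ h⟩
  · rintro ⟨s, -, h⟩
    obtain ⟨j, hj, hl⟩ := mem_seqW_iff.1 h
    exact mem_seqW_iff.2 ⟨j, hj.trans_le (stageIndex_le_card _), hl⟩

end Stages

/-! ## The meta-interpreter as an operator -/

section Meta

variable {α C : Type*}

/-- Unary ground atoms. -/
abbrev g1 (p : MetaPred) (x : C) : Literal (Atom MetaPred C) := .pos ⟨p, [x]⟩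

/-- Binary ground atoms. -/
abbrev g2 (p : MetaPred) (x y : C) : Literal (Atom MetaPred C) := .pos ⟨p, [x, y]⟩

/-- The immediate consequences of `J` under the non-disjunctive rules of the meta-interpreter and
the facts that represent `P`, where default negation is evaluated in `I`. -/
inductive MetaStep [LinearOrder C] (litName : Literal α → C) (ruleId : Rule α → C)
    (P : PrioritizedProgram α) (I J : Set (Literal (Atom MetaPred C))) :
    Literal (Atom MetaPred C) → Prop
  | rule {r} : r ∈ P.rules → MetaStep litName ruleId P I J (g1 .rule (ruleId r))
  | head {r l} : r ∈ P.rules → l ∈ r.H →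
      MetaStep litName ruleId P I J (g2 .head (litName l) (ruleId r))
  | pbl {r l} : r ∈ P.rules → l ∈ r.Bpos →
      MetaStep litName ruleId P I J (g2 .pbl (litName l) (ruleId r))
  | nbl {r l} : r ∈ P.rules → l ∈ r.Bneg →
      MetaStep litName ruleId P I J (g2 .nbl (litName l) (ruleId r))
  | compl {a} : Literal.pos a ∈ P.lits → Literal.neg a ∈ P.lits →
      MetaStep litName ruleId P I J (g2 .compl (litName (.pos a)) (litName (.neg a)))
  | pr {r r'} : r ∈ P.rules → r' ∈ P.rules → P.lt r r' →
      (¬ ∃ r'' ∈ P.rules, P.lt r r'' ∧ P.lt r'' r') →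
      MetaStep litName ruleId P I J (g2 .pr (ruleId r) (ruleId r'))
  | lit_head {x w} : g2 .head x w ∈ J → MetaStep litName ruleId P I J (g1 .lit x)
  | lit_pbl {x w} : g2 .pbl x w ∈ J → MetaStep litName ruleId P I J (g1 .lit x)
  | lit_nbl {x w} : g2 .nbl x w ∈ J → MetaStep litName ruleId P I J (g1 .lit x)
  | pr_trans {x y z} : g2 .pr x y ∈ J → g2 .pr y z ∈ J →
      MetaStep litName ruleId P I J (g2 .pr x z)
  | stage {s} : g1 .rule s ∈ J → MetaStep litName ruleId P I J (g1 .stage s)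
  | pos_body_false_S {x y} : g1 .rule y ∈ J → g2 .pbl x y ∈ J → g1 .in_S x ∉ I →
      MetaStep litName ruleId P I J (g1 .pos_body_false_S y)
  | pos_body_false_Si {l r s} : g2 .pbl l r ∈ J → g1 .stage s ∈ J → g2 .in_Si l s ∉ I →
      MetaStep litName ruleId P I J (g2 .pos_body_false_Si r s)
  | pos_body_false_S0 {l r} : g2 .pbl l r ∈ J →
      MetaStep litName ruleId P I J (g1 .pos_body_false_S0 r)
  | neg_body_false_S {x y} : g1 .rule y ∈ J → g2 .nbl x y ∈ J → g1 .in_S x ∈ J →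
      MetaStep litName ruleId P I J (g1 .neg_body_false_S y)
  | neg_body_false_Si {l r s} : g2 .nbl l r ∈ J → g1 .stage s ∈ J → g2 .in_Si l s ∈ J →
      MetaStep litName ruleId P I J (g2 .neg_body_false_Si r s)
  | active {r s} : g1 .rule r ∈ J → g1 .stage s ∈ J →
      g2 .pos_body_false_Si r s ∉ I → g1 .neg_body_false_S r ∉ I →
      MetaStep litName ruleId P I J (g2 .active r s)
  | active_Si {r s} : g1 .rule r ∈ J → g1 .stage s ∈ J →
      g1 .pos_body_false_S r ∉ I → g2 .neg_body_false_Si r s ∉ I →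
      MetaStep litName ruleId P I J (g2 .active_Si r s)
  | active_S0 {r} : g1 .rule r ∈ J →
      g1 .pos_body_false_S0 r ∉ I → g1 .neg_body_false_S r ∉ I →
      MetaStep litName ruleId P I J (g1 .active_S0 r)
  | head_not_in_Si {h r s} : g1 .stage s ∈ J → g2 .head h r ∈ J → g2 .in_Si h s ∉ I →
      MetaStep litName ruleId P I J (g2 .head_not_in_Si r s)
  | preferred {r' r s} : g2 .pr r' r ∈ J → g2 .active_Si r' s ∈ J →
      g2 .head_not_in_Si r' s ∈ J →
      MetaStep litName ruleId P I J (g2 .preferred_generating_rule_exists r s)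
  | preferred_S0 {r' r} : g2 .pr r' r ∈ J → g1 .pos_body_false_S r' ∉ I →
      MetaStep litName ruleId P I J (g1 .preferred_generating_rule_exists_S0 r)
  | in_Si {h r s' s} : g2 .head h r ∈ J → g2 .active r s' ∈ J → g1 .stage s' ∈ J →
      g1 .stage s ∈ J → s' < s → g2 .preferred_generating_rule_exists r s' ∉ I →
      MetaStep litName ruleId P I J (g2 .in_Si h s)
  | in_Si_S0 {h r s} : g2 .head h r ∈ J → g1 .active_S0 r ∈ J → g1 .stage s ∈ J →
      g1 .preferred_generating_rule_exists_S0 r ∉ I →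
      MetaStep litName ruleId P I J (g2 .in_Si h s)
  | in_PAS {l s} : g2 .in_Si l s ∈ J → MetaStep litName ruleId P I J (g1 .in_PAS l)

variable {litName : Literal α → C} {ruleId : Rule α → C}
  {P : PrioritizedProgram α}

/-- This splits the program into an explicit list of rules and six families of facts, so that each
rule can be instantiated separately. -/
theorem forall_metaRules_iff {p : VRule MetaPred MetaVar C → Prop} :
    (∀ r ∈ metaW C ∪ facts litName ruleId P, p r) ↔
      (∀ r ∈ metaRules C, p r) ∧
      (∀ r ∈ P.rules, p (fact .rule [ruleId r])) ∧
      (∀ r ∈ P.rules, ∀ l ∈ r.H, p (fact .head [litName l, ruleId r])) ∧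
      (∀ r ∈ P.rules, ∀ l ∈ r.Bpos, p (fact .pbl [litName l, ruleId r])) ∧
      (∀ r ∈ P.rules, ∀ l ∈ r.Bneg, p (fact .nbl [litName l, ruleId r])) ∧
      (∀ a, Literal.pos a ∈ P.lits → Literal.neg a ∈ P.lits →
        p (fact .compl [litName (.pos a), litName (.neg a)])) ∧
      (∀ r ∈ P.rules, ∀ r' ∈ P.rules, P.lt r r' →
        (¬ ∃ r'' ∈ P.rules, P.lt r r'' ∧ P.lt r'' r') →
        p (fact .pr [ruleId r, ruleId r'])) := by
  constructor
  · intro h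
    refine ⟨fun r hr => h r (Or.inl hr), fun r hr => h _ (Or.inr ?_),
      fun r hr l hl => h _ (Or.inr ?_), fun r hr l hl => h _ (Or.inr ?_),
      fun r hr l hl => h _ (Or.inr ?_), fun a h₁ h₂ => h _ (Or.inr ?_),
      fun r hr r' hr' h₁ h₂ => h _ (Or.inr ?_)⟩
    · exact Or.inl (Or.inl (Or.inl (Or.inl (Or.inl ⟨r, hr, rfl⟩))))
    · exact Or.inl (Or.inl (Or.inl (Or.inl (Or.inr ⟨r, hr, l, hl, rfl⟩))))
    · exact Or.inl (Or.inl (Or.inl (Or.inr ⟨r, hr, l, hl, rfl⟩)))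
    · exact Or.inl (Or.inl (Or.inr ⟨r, hr, l, hl, rfl⟩))
    · exact Or.inl (Or.inr ⟨a, h₁, h₂, rfl⟩)
    · exact Or.inr ⟨r, hr, r', hr', h₁, h₂, rfl⟩
  · rintro ⟨h₀, h₁, h₂, h₃, h₄, h₅, h₆⟩ r
      (hr | (((((⟨r, hr, rfl⟩ | ⟨r, hr, l, hl, rfl⟩) | ⟨r, hr, l, hl, rfl⟩) | ⟨r, hr, l, hl, rfl⟩)
        | ⟨a, ha, ha', rfl⟩) | ⟨r, hr, r', hr', hlt, hred, rfl⟩))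
    · exact h₀ r hr
    · exact h₁ r hr
    · exact h₂ r hr l hl
    · exact h₃ r hr l hl
    · exact h₄ r hr l hl
    · exact h₅ a ha ha'
    · exact h₆ r hr r' hr' hlt hred

/-- `J` is closed under the disjunctive rule and the constraints of the meta-interpreter, where
default negation is evaluated in `I`. -/
structure MetaGuess (I J : Set (Literal (Atom MetaPred C))) : Prop where
  guess : ∀ x, g1 .lit x ∈ J → g1 .in_S x ∈ J ∨ g1 .notin_S x ∈ J
  compl : ∀ x y, g2 .compl x y ∈ J → g1 .in_S x ∈ J → g1 .in_S y ∉ J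
  pr_irrefl : ∀ x, g2 .pr x x ∉ J
  in_S_of_in_PAS : ∀ x, g1 .in_PAS x ∈ J → g1 .in_S x ∈ I
  in_PAS_of_in_S : ∀ x, g1 .in_S x ∈ J → g1 .in_PAS x ∈ I

theorem args_mem_universe [Inhabited C] {Q : Set (VRule MetaPred MetaVar C)}
    {J : Set (Literal (Atom MetaPred C))} (hJ : J ⊆ herbrandBase Q) :
    (∀ p x, g1 p x ∈ J → x ∈ herbrandUniverse Q) ∧
    (∀ p x y, g2 p x y ∈ J → x ∈ herbrandUniverse Q ∧ y ∈ herbrandUniverse Q) := by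
  refine ⟨fun p x h => (hJ h).2 x ?_, fun p x y h => ⟨(hJ h).2 x ?_, (hJ h).2 y ?_⟩⟩ <;>
    simp [Literal.atom]

theorem ruleId_mem_universe [Inhabited C] {r : Rule α} (hr : r ∈ P.rules) :
    ruleId r ∈ herbrandUniverse (metaW C ∪ facts litName ruleId P) := by
  refine mem_herbrandUniverse (r := fact .rule [ruleId r])
    (.inr (.inl (.inl (.inl (.inl (.inl ⟨r, hr, rfl⟩)))))) ?_
  simp [VRule.consts, VRule.atoms, fact, Literal.atom]

theorem litName_mem_universe [Inhabited C] {l : Literal α} (hl : l ∈ P.lits) :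
    litName l ∈ herbrandUniverse (metaW C ∪ facts litName ruleId P) := by
  obtain ⟨r, hr, (hl | hl) | hl⟩ := hl
  · refine mem_herbrandUniverse (r := fact .head [litName l, ruleId r])
      (.inr (.inl (.inl (.inl (.inl (.inr ⟨r, hr, l, hl, rfl⟩)))))) ?_
    simp [VRule.consts, VRule.atoms, fact, Literal.atom]
  · refine mem_herbrandUniverse (r := fact .pbl [litName l, ruleId r])
      (.inr (.inl (.inl (.inl (.inr ⟨r, hr, l, hl, rfl⟩))))) ?_
    simp [VRule.consts, VRule.atoms, fact, Literal.atom]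
  · refine mem_herbrandUniverse (r := fact .nbl [litName l, ruleId r])
      (.inr (.inl (.inl (.inr ⟨r, hr, l, hl, rfl⟩)))) ?_
    simp [VRule.consts, VRule.atoms, fact, Literal.atom]

variable [LinearOrder C]

/-- Literals of `J` contain only constants of the Herbrand universe, so a body satisfied in `J`
always comes from an admissible assignment. The universe can therefore be forgotten from here on. -/
theorem closedUnder_reduct_meta_iff [Inhabited C] {I J : Set (Literal (Atom MetaPred C))}
    (hJ : J ⊆ herbrandBase (metaW C ∪ facts litName ruleId P)) :
    ClosedUnder (reduct (ground (metaW C ∪ facts litName ruleId P)) I) J ↔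
      (∀ l, MetaStep litName ruleId P I J l → l ∈ J) ∧ MetaGuess I J := by
  obtain ⟨h1, h2⟩ := args_mem_universe hJ
  rw [closedUnder_reduct_ground_iff]
  generalize hU : herbrandUniverse (metaW C ∪ facts litName ruleId P) = U at h1 h2
  rw [forall_metaRules_iff]
  simp only [metaRules, List.forall_mem_cons, List.not_mem_nil, fact, instLit, Literal.map,
    Atom.map, Term.inst, VRule.CmpTrue, a1, a2, List.map, false_imp_iff, implies_true, and_true,
    true_imp_iff, List.exists_mem_cons_iff, false_and, exists_false, or_false]
  -- Facts have no variables but are still instantiated by an assignment on all of `MetaVar`; the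
  -- constant `u` serves for it.
  obtain ⟨u, hu⟩ : U.Nonempty := hU ▸ herbrandUniverse_nonempty _
  constructor
  · rintro ⟨⟨c1, c2, c3, c4, c5, c6, c7, c8, c9, c10, c11, c12, c13, c14, c15, c16, c17, c18, c19,
      c20, c21, c22, c23, c24⟩, f1, f2, f3, f4, f5, f6⟩
    refine ⟨fun l hl => ?_, ?_, ?_, ?_, ?_, ?_⟩
    · cases hl with
      | rule hr => exact f1 _ hr (fun _ => u) fun _ => hu
      | head hr hl => exact f2 _ hr _ hl (fun _ => u) fun _ => hu
      | pbl hr hl => exact f3 _ hr _ hl (fun _ => u) fun _ => hu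
      | nbl hr hl => exact f4 _ hr _ hl (fun _ => u) fun _ => hu
      | compl ha ha' => exact f5 _ ha ha' (fun _ => u) fun _ => hu
      | pr hr hr' hlt hred => exact f6 _ hr _ hr' hlt hred (fun _ => u) fun _ => hu
      | @lit_head x w h =>
        have := h2 _ _ _ h
        -- The catch-all arm also assigns the variables that are absent from the rule, which must
        -- still take values in the universe. The same device serves the other rules.
        exact c1 (fun | .L => x | _ => w) (by rintro ⟨⟩ <;> simp [*]) h
      | @lit_pbl x w h =>
        have := h2 _ _ _ h
        exact c2 (fun | .L => x | _ => w) (by rintro ⟨⟩ <;> simp [*]) h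
      | @lit_nbl x w h =>
        have := h2 _ _ _ h
        exact c3 (fun | .L => x | _ => w) (by rintro ⟨⟩ <;> simp [*]) h
      | @pr_trans x y z h h' =>
        have := h2 _ _ _ h
        have := h2 _ _ _ h'
        exact c6 (fun | .X => x | .Y => y | _ => z) (by rintro ⟨⟩ <;> simp [*]) ⟨h, h'⟩
      | @stage s h =>
        have := h1 _ _ h
        exact c8 (fun _ => s) (by rintro ⟨⟩ <;> simp [*]) h
      | @pos_body_false_S x y h h' n =>
        have := h1 _ _ h
        have := h2 _ _ _ h'
        exact c9 (fun | .X => x | _ => y) (by rintro ⟨⟩ <;> simp [*]) n ⟨h, h'⟩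
      | @pos_body_false_Si l r s h h' n =>
        have := h2 _ _ _ h
        have := h1 _ _ h'
        exact c10 (fun | .L => l | .Si => s | _ => r) (by rintro ⟨⟩ <;> simp [*]) n ⟨h, h'⟩
      | @pos_body_false_S0 l r h =>
        have := h2 _ _ _ h
        exact c11 (fun | .L => l | _ => r) (by rintro ⟨⟩ <;> simp [*]) h
      | @neg_body_false_S x y h h' h'' =>
        have := h1 _ _ h
        have := h2 _ _ _ h'
        have := h1 _ _ h''
        exact c12 (fun | .X => x | _ => y) (by rintro ⟨⟩ <;> simp [*]) ⟨h, h', h''⟩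
      | @neg_body_false_Si l r s h h' h'' =>
        have := h2 _ _ _ h
        have := h1 _ _ h'
        have := h2 _ _ _ h''
        exact c13 (fun | .L => l | .Si => s | _ => r) (by rintro ⟨⟩ <;> simp [*]) ⟨h, h', h''⟩
      | @active r s h h' n n' =>
        have := h1 _ _ h
        have := h1 _ _ h'
        exact c14 (fun | .Si => s | _ => r) (by rintro ⟨⟩ <;> simp [*]) ⟨n, n'⟩ ⟨h, h'⟩
      | @active_Si r s h h' n n' =>
        have := h1 _ _ h
        have := h1 _ _ h'
        exact c15 (fun | .Si => s | _ => r) (by rintro ⟨⟩ <;> simp [*]) ⟨n, n'⟩ ⟨h, h'⟩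
      | @active_S0 r h n n' =>
        have := h1 _ _ h
        exact c16 (fun _ => r) (by rintro ⟨⟩ <;> simp [*]) ⟨n, n'⟩ h
      | @head_not_in_Si x r s h h' n =>
        have := h1 _ _ h
        have := h2 _ _ _ h'
        exact c17 (fun | .H => x | .Si => s | _ => r) (by rintro ⟨⟩ <;> simp [*]) n ⟨h, h'⟩
      | @preferred r' r s h h' h'' =>
        have := h2 _ _ _ h
        have := h2 _ _ _ h'
        have := h2 _ _ _ h''
        exact c18 (fun | .R1 => r' | .Si => s | _ => r) (by rintro ⟨⟩ <;> simp [*]) ⟨h, h', h''⟩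
      | @preferred_S0 r' r h n =>
        have := h2 _ _ _ h
        exact c19 (fun | .R1 => r' | _ => r) (by rintro ⟨⟩ <;> simp [*]) n h
      | @in_Si x r s' s h ha hs' hs hlt n =>
        have := h2 _ _ _ h
        have := h2 _ _ _ ha
        have := h1 _ _ hs'
        have := h1 _ _ hs
        exact c20 (fun | .H => x | .Si => s | .Sj => s' | _ => r) (by rintro ⟨⟩ <;> simp [*]) hlt n ⟨h, ha, hs', hs⟩
      | @in_Si_S0 x r s h ha hs n =>
        have := h2 _ _ _ h
        have := h1 _ _ ha
        have := h1 _ _ hs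
        exact c21 (fun | .H => x | .Si => s | _ => r) (by rintro ⟨⟩ <;> simp [*]) n ⟨h, ha, hs⟩
      | @in_PAS x s h =>
        have := h2 _ _ _ h
        exact c22 (fun | .L => x | _ => s) (by rintro ⟨⟩ <;> simp [*]) h
    · exact fun x h => c4 (fun _ => x) (fun _ => h1 _ _ h) h
    · intro x y h hx hy
      have := h2 _ _ _ h
      exact c5 (fun | .X => x | _ => y) (by rintro ⟨⟩ <;> simp [*]) ⟨h, hx, hy⟩
    · exact fun x h => c7 (fun _ => x) (fun _ => (h2 _ _ _ h).1) h
    -- A constraint survives in the reduct only if its negated literal is missing from `I`; hence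
    -- the conclusion is about `I` while the premise is about `J`.
    · exact fun x h => by_contra fun n => c23 (fun _ => x) (fun _ => h1 _ _ h) n h
    · exact fun x h => by_contra fun n => c24 (fun _ => x) (fun _ => h1 _ _ h) n h
  · rintro ⟨hs, hg⟩
    exact ⟨⟨fun θ _ h => hs _ (.lit_head h), fun θ _ h => hs _ (.lit_pbl h),
      fun θ _ h => hs _ (.lit_nbl h), fun θ _ h => hg.guess _ h,
      fun θ _ h => hg.compl _ _ h.1 h.2.1 h.2.2, fun θ _ h => hs _ (.pr_trans h.1 h.2),
      fun θ _ h => hg.pr_irrefl _ h, fun θ _ h => hs _ (.stage h),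
      fun θ _ n h => hs _ (.pos_body_false_S h.1 h.2 n),
      fun θ _ n h => hs _ (.pos_body_false_Si h.1 h.2 n),
      fun θ _ h => hs _ (.pos_body_false_S0 h),
      fun θ _ h => hs _ (.neg_body_false_S h.1 h.2.1 h.2.2),
      fun θ _ h => hs _ (.neg_body_false_Si h.1 h.2.1 h.2.2),
      fun θ _ n h => hs _ (.active h.1 h.2 n.1 n.2),
      fun θ _ n h => hs _ (.active_Si h.1 h.2 n.1 n.2),
      fun θ _ n h => hs _ (.active_S0 h n.1 n.2),
      fun θ _ n h => hs _ (.head_not_in_Si h.1 h.2 n),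
      fun θ _ h => hs _ (.preferred h.1 h.2.1 h.2.2), fun θ _ n h => hs _ (.preferred_S0 h n),
      fun θ _ hlt n h => hs _ (.in_Si h.1 h.2.1 h.2.2.1 h.2.2.2 hlt n),
      fun θ _ n h => hs _ (.in_Si_S0 h.1 h.2.1 h.2.2 n), fun θ _ h => hs _ (.in_PAS h),
      fun θ _ n h => n (hg.in_S_of_in_PAS _ h), fun θ _ n h => n (hg.in_PAS_of_in_S _ h)⟩,
      fun r hr _ _ => hs _ (.rule hr), fun r hr l hl _ _ => hs _ (.head hr hl),
      fun r hr l hl _ _ => hs _ (.pbl hr hl), fun r hr l hl _ _ => hs _ (.nbl hr hl),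
      fun a ha ha' _ _ => hs _ (.compl ha ha'),
      fun r hr r' hr' hlt hred _ _ => hs _ (.pr hr hr' hlt hred)⟩

/-- This is the inversion counterpart of closure. Keeping `I` and `J` apart allows `J` to be the
part of an answer set on which an induction hypothesis holds. -/
theorem metaStep_of_instance {I J : Set (Literal (Atom MetaPred C))} :
    ∀ r ∈ metaW C ∪ facts litName ruleId P, ∀ θ : MetaVar → C, r.CmpTrue θ →
      (∀ l ∈ r.neg, instLit θ l ∉ I) → (∀ l ∈ r.pos, instLit θ l ∈ J) →
      ∀ l ∈ r.head, MetaStep litName ruleId P I J (instLit θ l) ∨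
        ∃ x, g1 .lit x ∈ J ∧ (instLit θ l = g1 .in_S x ∨ instLit θ l = g1 .notin_S x) := by
  rw [forall_metaRules_iff]
  simp only [metaRules, List.forall_mem_cons, List.not_mem_nil, fact, instLit, Literal.map,
    Atom.map, Term.inst, VRule.CmpTrue, a1, a2, List.map, false_imp_iff, implies_true, and_true,
    true_imp_iff, true_and]
  exact ⟨⟨fun θ h => .inl (.lit_head h), fun θ h => .inl (.lit_pbl h),
    fun θ h => .inl (.lit_nbl h), fun θ h => ⟨.inr ⟨_, h, .inl rfl⟩, .inr ⟨_, h, .inr rfl⟩⟩,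
    fun θ h => .inl (.pr_trans h.1 h.2),
    fun θ h => .inl (.stage h),
    fun θ n h => .inl (.pos_body_false_S h.1 h.2 n),
    fun θ n h => .inl (.pos_body_false_Si h.1 h.2 n),
    fun θ h => .inl (.pos_body_false_S0 h),
    fun θ h => .inl (.neg_body_false_S h.1 h.2.1 h.2.2),
    fun θ h => .inl (.neg_body_false_Si h.1 h.2.1 h.2.2),
    fun θ n h => .inl (.active h.1 h.2 n.1 n.2),
    fun θ n h => .inl (.active_Si h.1 h.2 n.1 n.2),
    fun θ n h => .inl (.active_S0 h n.1 n.2),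
    fun θ n h => .inl (.head_not_in_Si h.1 h.2 n),
    fun θ h => .inl (.preferred h.1 h.2.1 h.2.2), fun θ n h => .inl (.preferred_S0 h n),
    fun θ hlt n h => .inl (.in_Si h.1 h.2.1 h.2.2.1 h.2.2.2 hlt n),
    fun θ n h => .inl (.in_Si_S0 h.1 h.2.1 h.2.2 n), fun θ h => .inl (.in_PAS h)⟩,
    fun r hr _ => .inl (.rule hr), fun r hr l hl _ => .inl (.head hr hl),
    fun r hr l hl _ => .inl (.pbl hr hl), fun r hr l hl _ => .inl (.nbl hr hl),
    fun a ha ha' _ => .inl (.compl ha ha'),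
    fun r hr r' hr' hlt hred _ => .inl (.pr hr hr' hlt hred)⟩

/-- The literals of an answer set are derived by the meta-interpreter. -/
theorem metaStep_of_mem_answerSets [Inhabited C] {A : Set (Literal (Atom MetaPred C))}
    (hA : A ∈ answerSets (metaW C ∪ facts litName ruleId P)) {l : Literal (Atom MetaPred C)}
    (hl : l ∈ A) :
    MetaStep litName ruleId P A A l ∨
      ∃ x, g1 .lit x ∈ A ∧ (l = g1 .in_S x ∨ l = g1 .notin_S x) := by
  obtain ⟨r, hr, θ, hc, hn, hp, l', hl', rfl⟩ := answerSets_supported hA l hl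
  exact metaStep_of_instance r hr θ hc hn hp l' hl'

/-- Support alone would allow `pr` atoms to justify each other in a circle through transitivity, so
the induction principle given by minimality is used. Injectivity of `ruleId` lets two composable
pairs share their middle rule. -/
theorem lt_of_pr_mem_answerSets [Inhabited C] (hid : Set.InjOn ruleId {r | r ∈ P.rules})
    {A : Set (Literal (Atom MetaPred C))}
    (hA : A ∈ answerSets (metaW C ∪ facts litName ruleId P)) {x y : C} (h : g2 .pr x y ∈ A) :
    ∃ r ∈ P.rules, ∃ r' ∈ P.rules, P.lt r r' ∧ ruleId r = x ∧ ruleId r' = y := by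
  refine answerSets_induction hA (fun l => ∀ x y, l = g2 .pr x y →
    ∃ r ∈ P.rules, ∃ r' ∈ P.rules, P.lt r r' ∧ ruleId r = x ∧ ruleId r' = y) ?_ _ h x y rfl
  intro r hr θ _ hc hn hp l hl x y he
  have := metaStep_of_instance (J := {l | l ∈ A ∧ ∀ x y, l = g2 .pr x y →
    ∃ r ∈ P.rules, ∃ r' ∈ P.rules, P.lt r r' ∧ ruleId r = x ∧ ruleId r' = y}) r hr θ hc hn hp l hl
  rw [he] at this
  rcases this with h | ⟨_, _, h | h⟩
  · cases h with
    | pr hr hr' hlt _ => exact ⟨_, hr, _, hr', hlt, rfl, rfl⟩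
    | pr_trans h₁ h₂ =>
      obtain ⟨r, hr, r', hr', hlt, rfl, h'⟩ := h₁.2 _ _ rfl
      obtain ⟨s, hs, s', hs', hlt', h'', rfl⟩ := h₂.2 _ _ rfl
      obtain rfl := hid hr' hs (h'.trans h''.symm)
      exact ⟨r, hr, s', hs', P.trans _ hr _ hr' _ hs' hlt hlt', rfl, rfl⟩
  · simp at h
  · simp at h

open Classical in
/-- The transitive closure of the transitive reduction is the order. -/
theorem pr_mem_of_lt {I J : Set (Literal (Atom MetaPred C))}
    (h : ∀ l, MetaStep litName ruleId P I J l → l ∈ J) {r r' : Rule α} (hr : r ∈ P.rules)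
    (hr' : r' ∈ P.rules) (hlt : P.lt r r') : g2 .pr (ruleId r) (ruleId r') ∈ J := by
  -- The induction is on the number of rules strictly between `r` and `r'`. An intermediate `s`
  -- splits the interval into two parts, each smaller because `s` itself drops out; with no
  -- intermediate rule the pair is a fact.
  induction hn : (P.rules.filter fun s => P.lt r s ∧ P.lt s r').card using Nat.strong_induction_on
    generalizing r r' with
  | _ n ih =>
    by_cases hred : ∃ s ∈ P.rules, P.lt r s ∧ P.lt s r'
    · obtain ⟨s, hs, h₁, h₂⟩ := hred
      refine h _ (.pr_trans (ih _ ?_ hr hs h₁ rfl) (ih _ ?_ hs hr' h₂ rfl)) <;> subst hn <;>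
        refine Finset.card_lt_card (Finset.ssubset_iff_of_subset ?_ |>.2 ⟨s, ?_, ?_⟩)
      · intro t
        simp only [Finset.mem_filter]
        exact fun ⟨ht, h₃, h₄⟩ => ⟨ht, h₃, P.trans _ ht _ hs _ hr' h₄ h₂⟩
      · simp [*]
      · simp [P.irrefl _ hs]
      · intro t
        simp only [Finset.mem_filter]
        exact fun ⟨ht, h₃, h₄⟩ => ⟨ht, P.trans _ hr _ hs _ ht h₁ h₃, h₄⟩
      · simp [*]
      · simp [P.irrefl _ hs]
    · exact h _ (.pr hr hr' hlt hred)

end Meta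

/-! ### Soundness: answer sets yield W-preferred answer sets -/

section Soundness

variable {α C : Type*} [Inhabited C] [LinearOrder C] {litName : Literal α → C}
  {ruleId : Rule α → C} {P : PrioritizedProgram α}

theorem not_disjoint_iff {B S : Set (Literal α)} : ¬ B ∩ S = ∅ ↔ ∃ l ∈ B, l ∈ S :=
  Set.nonempty_iff_ne_empty.symm

/-- `S` is read off from `in_S`, and a candidate stage `T c` from `in_Si`. In each equivalence for
an auxiliary predicate, support gives one direction and closure the other; injectivity of the names
recovers the rule or literal behind a constant. -/
theorem projPAS_mem_WPAS (hlit : Function.Injective litName)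
    (hid : Set.InjOn ruleId {r | r ∈ P.rules}) {A : Set (Literal (Atom MetaPred C))}
    (hA : A ∈ answerSets (metaW C ∪ facts litName ruleId P)) :
    projPAS litName A ∈ P.WPAS := by
  obtain ⟨hs, hg⟩ := (closedUnder_reduct_meta_iff hA.1.1).1 hA.1.2.2
  have step : ∀ {l}, l ∈ A → (∀ x, l ≠ g1 .in_S x ∧ l ≠ g1 .notin_S x) →
      MetaStep litName ruleId P A A l := by
    intro l hl hne
    rcases metaStep_of_mem_answerSets hA hl with h | ⟨x, -, h | h⟩
    · exact h
    · exact absurd h (hne x).1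
    · exact absurd h (hne x).2
  have rule_of : ∀ {r}, r ∈ P.rules → g1 .rule (ruleId r) ∈ A := fun hr => hs _ (.rule hr)
  have stage_of : ∀ {r}, r ∈ P.rules → g1 .stage (ruleId r) ∈ A := fun hr =>
    hs _ (.stage (rule_of hr))
  have rule_inv : ∀ {x}, g1 .rule x ∈ A → ∃ r ∈ P.rules, ruleId r = x := by
    intro x h
    cases step h (by simp) with
    | rule hr => exact ⟨_, hr, rfl⟩
  have stage_inv : ∀ {x}, g1 .stage x ∈ A → ∃ r ∈ P.rules, ruleId r = x := by
    intro x h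
    cases step h (by simp) with
    | stage h => exact rule_inv h
  have head_inv' : ∀ {x y}, g2 .head x y ∈ A →
      ∃ r ∈ P.rules, ∃ l ∈ r.H, litName l = x ∧ ruleId r = y := by
    intro x y h
    cases step h (by simp) with
    | head hr hl => exact ⟨_, hr, _, hl, rfl, rfl⟩
  have pbl_inv' : ∀ {x y}, g2 .pbl x y ∈ A →
      ∃ r ∈ P.rules, ∃ l ∈ r.Bpos, litName l = x ∧ ruleId r = y := by
    intro x y h
    cases step h (by simp) with
    | pbl hr hl => exact ⟨_, hr, _, hl, rfl, rfl⟩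
  have nbl_inv' : ∀ {x y}, g2 .nbl x y ∈ A →
      ∃ r ∈ P.rules, ∃ l ∈ r.Bneg, litName l = x ∧ ruleId r = y := by
    intro x y h
    cases step h (by simp) with
    | nbl hr hl => exact ⟨_, hr, _, hl, rfl, rfl⟩
  have head_inv : ∀ {r}, r ∈ P.rules → ∀ {x}, g2 .head x (ruleId r) ∈ A →
      ∃ l ∈ r.H, litName l = x := by
    intro r hr x h
    obtain ⟨r', hr', l, hl, rfl, he⟩ := head_inv' h
    obtain rfl := hid hr' hr he
    exact ⟨l, hl, rfl⟩
  have pbl_inv : ∀ {r}, r ∈ P.rules → ∀ {x}, g2 .pbl x (ruleId r) ∈ A →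
      ∃ l ∈ r.Bpos, litName l = x := by
    intro r hr x h
    obtain ⟨r', hr', l, hl, rfl, he⟩ := pbl_inv' h
    obtain rfl := hid hr' hr he
    exact ⟨l, hl, rfl⟩
  have nbl_inv : ∀ {r}, r ∈ P.rules → ∀ {x}, g2 .nbl x (ruleId r) ∈ A →
      ∃ l ∈ r.Bneg, litName l = x := by
    intro r hr x h
    obtain ⟨r', hr', l, hl, rfl, he⟩ := nbl_inv' h
    obtain rfl := hid hr' hr he
    exact ⟨l, hl, rfl⟩
  have lit_inv : ∀ {x}, g1 .lit x ∈ A → ∃ l ∈ P.lits, litName l = x := by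
    intro x h
    cases step h (by simp) with
    | lit_head h =>
      obtain ⟨r, hr, l, hl, rfl, -⟩ := head_inv' h
      exact ⟨l, ⟨r, hr, .inl (.inl hl)⟩, rfl⟩
    | lit_pbl h =>
      obtain ⟨r, hr, l, hl, rfl, -⟩ := pbl_inv' h
      exact ⟨l, ⟨r, hr, .inl (.inr hl)⟩, rfl⟩
    | lit_nbl h =>
      obtain ⟨r, hr, l, hl, rfl, -⟩ := nbl_inv' h
      exact ⟨l, ⟨r, hr, .inr hl⟩, rfl⟩
  have pr_inv : ∀ {r}, r ∈ P.rules → ∀ {x}, g2 .pr x (ruleId r) ∈ A →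
      ∃ r' ∈ P.rules, P.lt r' r ∧ ruleId r' = x := by
    intro r hr x h
    obtain ⟨r', hr', s, hs, hlt, rfl, he⟩ := lt_of_pr_mem_answerSets hid hA h
    obtain rfl := hid hs hr he
    exact ⟨r', hr', hlt, rfl⟩
  set S : Set (Literal α) := {l | g1 .in_S (litName l) ∈ A} with hS
  set T : C → Set (Literal α) := fun c => {l | g2 .in_Si (litName l) c ∈ A} with hT
  have S_lits : S ⊆ P.lits := by
    intro l hl
    -- No constructor of `MetaStep` produces `in_S`, so the atom stems from the guess, which ranges
    -- only over literals occurring in `P`.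
    rcases metaStep_of_mem_answerSets hA hl with h | ⟨x, hx, h⟩
    · generalize litName l = x at h
      cases h
    · obtain ⟨l', hl', rfl⟩ := lit_inv hx
      have : l = l' := by simpa [hlit.eq_iff] using h
      exact this ▸ hl'
  have pos_S : ∀ {r}, r ∈ P.rules → (g1 .pos_body_false_S (ruleId r) ∈ A ↔ ¬ r.Bpos ⊆ S) := by
    intro r hr
    rw [Set.not_subset]
    constructor
    · intro h
      obtain ⟨x, hp, hn⟩ : ∃ x, g2 .pbl x (ruleId r) ∈ A ∧ g1 .in_S x ∉ A := by
        generalize ruleId r = y at h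
        cases step h (by simp) with
        | pos_body_false_S _ hp hn => exact ⟨_, hp, hn⟩
      obtain ⟨l, hl, rfl⟩ := pbl_inv hr hp
      exact ⟨l, hl, hn⟩
    · rintro ⟨l, hl, hn⟩
      exact hs _ (.pos_body_false_S (rule_of hr) (hs _ (.pbl hr hl)) hn)
  have pos_Si : ∀ {r s}, r ∈ P.rules → s ∈ P.rules →
      (g2 .pos_body_false_Si (ruleId r) (ruleId s) ∈ A ↔ ¬ r.Bpos ⊆ T (ruleId s)) := by
    intro r s hr hs'
    rw [Set.not_subset]
    constructor
    · intro h
      obtain ⟨x, hp, hn⟩ : ∃ x, g2 .pbl x (ruleId r) ∈ A ∧ g2 .in_Si x (ruleId s) ∉ A := by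
        generalize ruleId r = y, ruleId s = z at h
        cases step h (by simp) with
        | pos_body_false_Si hp _ hn => exact ⟨_, hp, hn⟩
      obtain ⟨l, hl, rfl⟩ := pbl_inv hr hp
      exact ⟨l, hl, hn⟩
    · rintro ⟨l, hl, hn⟩
      exact hs _ (.pos_body_false_Si (hs _ (.pbl hr hl)) (stage_of hs') hn)
  have pos_S0 : ∀ {r}, r ∈ P.rules →
      (g1 .pos_body_false_S0 (ruleId r) ∈ A ↔ ¬ r.Bpos ⊆ ∅) := by
    intro r hr
    rw [Set.not_subset]
    constructor
    · intro h
      obtain ⟨x, hp⟩ : ∃ x, g2 .pbl x (ruleId r) ∈ A := by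
        generalize ruleId r = y at h
        cases step h (by simp) with
        | pos_body_false_S0 hp => exact ⟨_, hp⟩
      obtain ⟨l, hl, rfl⟩ := pbl_inv hr hp
      exact ⟨l, hl, Set.notMem_empty l⟩
    · rintro ⟨l, hl, -⟩
      exact hs _ (.pos_body_false_S0 (hs _ (.pbl hr hl)))
  have neg_S : ∀ {r}, r ∈ P.rules →
      (g1 .neg_body_false_S (ruleId r) ∈ A ↔ ¬ r.Bneg ∩ S = ∅) := by
    intro r hr
    rw [not_disjoint_iff]
    constructor
    · intro h
      obtain ⟨x, hp, hn⟩ : ∃ x, g2 .nbl x (ruleId r) ∈ A ∧ g1 .in_S x ∈ A := by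
        generalize ruleId r = y at h
        cases step h (by simp) with
        | neg_body_false_S _ hp hn => exact ⟨_, hp, hn⟩
      obtain ⟨l, hl, rfl⟩ := nbl_inv hr hp
      exact ⟨l, hl, hn⟩
    · rintro ⟨l, hl, hn⟩
      exact hs _ (.neg_body_false_S (rule_of hr) (hs _ (.nbl hr hl)) hn)
  have neg_Si : ∀ {r s}, r ∈ P.rules → s ∈ P.rules →
      (g2 .neg_body_false_Si (ruleId r) (ruleId s) ∈ A ↔ ¬ r.Bneg ∩ T (ruleId s) = ∅) := by
    intro r s hr hs'
    rw [not_disjoint_iff]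
    constructor
    · intro h
      obtain ⟨x, hp, hn⟩ : ∃ x, g2 .nbl x (ruleId r) ∈ A ∧ g2 .in_Si x (ruleId s) ∈ A := by
        generalize ruleId r = y, ruleId s = z at h
        cases step h (by simp) with
        | neg_body_false_Si hp _ hn => exact ⟨_, hp, hn⟩
      obtain ⟨l, hl, rfl⟩ := nbl_inv hr hp
      exact ⟨l, hl, hn⟩
    · rintro ⟨l, hl, hn⟩
      exact hs _ (.neg_body_false_Si (hs _ (.nbl hr hl)) (stage_of hs') hn)
  have active_iff : ∀ {r s}, r ∈ P.rules → s ∈ P.rules →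
      (g2 .active (ruleId r) (ruleId s) ∈ A ↔ r.Active (T (ruleId s)) S) := by
    intro r s hr hs'
    have h₁ := not_congr (pos_Si hr hs')
    have h₂ := not_congr (neg_S hr)
    rw [not_not] at h₁ h₂
    rw [Rule.Active, ← h₁, ← h₂]
    constructor
    · intro h
      generalize ruleId r = y, ruleId s = z at h
      cases step h (by simp) with
      | active _ _ h₁ h₂ => exact ⟨h₁, h₂⟩
    · exact fun h => hs _ (.active (rule_of hr) (stage_of hs') h.1 h.2)
  have active_Si_iff : ∀ {r s}, r ∈ P.rules → s ∈ P.rules →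
      (g2 .active_Si (ruleId r) (ruleId s) ∈ A ↔ r.Active S (T (ruleId s))) := by
    intro r s hr hs'
    have h₁ := not_congr (pos_S hr)
    have h₂ := not_congr (neg_Si hr hs')
    rw [not_not] at h₁ h₂
    rw [Rule.Active, ← h₁, ← h₂]
    constructor
    · intro h
      generalize ruleId r = y, ruleId s = z at h
      cases step h (by simp) with
      | active_Si _ _ h₁ h₂ => exact ⟨h₁, h₂⟩
    · exact fun h => hs _ (.active_Si (rule_of hr) (stage_of hs') h.1 h.2)
  have active_S0_iff : ∀ {r}, r ∈ P.rules →
      (g1 .active_S0 (ruleId r) ∈ A ↔ r.Active ∅ S) := by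
    intro r hr
    have h₁ := not_congr (pos_S0 hr)
    have h₂ := not_congr (neg_S hr)
    rw [not_not] at h₁ h₂
    rw [Rule.Active, ← h₁, ← h₂]
    constructor
    · intro h
      generalize ruleId r = y at h
      cases step h (by simp) with
      | active_S0 _ h₁ h₂ => exact ⟨h₁, h₂⟩
    · exact fun h => hs _ (.active_S0 (rule_of hr) h.1 h.2)
  have head_not_iff : ∀ {r s}, r ∈ P.rules → s ∈ P.rules →
      (g2 .head_not_in_Si (ruleId r) (ruleId s) ∈ A ↔ ¬ r.H ⊆ T (ruleId s)) := by
    intro r s hr hs'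
    rw [Set.not_subset]
    constructor
    · intro h
      obtain ⟨x, hp, hn⟩ : ∃ x, g2 .head x (ruleId r) ∈ A ∧ g2 .in_Si x (ruleId s) ∉ A := by
        generalize ruleId r = y, ruleId s = z at h
        cases step h (by simp) with
        | head_not_in_Si _ hp hn => exact ⟨_, hp, hn⟩
      obtain ⟨l, hl, rfl⟩ := head_inv hr hp
      exact ⟨l, hl, hn⟩
    · rintro ⟨l, hl, hn⟩
      exact hs _ (.head_not_in_Si (stage_of hs') (hs _ (.head hr hl)) hn)
  have pref_iff : ∀ {r s}, r ∈ P.rules → s ∈ P.rules →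
      (g2 .preferred_generating_rule_exists (ruleId r) (ruleId s) ∈ A ↔
        ∃ r' ∈ P.rules, P.lt r' r ∧ r'.Active S (T (ruleId s)) ∧ ¬ r'.H ⊆ T (ruleId s)) := by
    intro r s hr hs'
    constructor
    · intro h
      obtain ⟨x, hp, ha, hn⟩ : ∃ x, g2 .pr x (ruleId r) ∈ A ∧
          g2 .active_Si x (ruleId s) ∈ A ∧ g2 .head_not_in_Si x (ruleId s) ∈ A := by
        generalize ruleId r = y, ruleId s = z at h
        cases step h (by simp) with
        | preferred hp ha hn => exact ⟨_, hp, ha, hn⟩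
      obtain ⟨r', hr', hlt, rfl⟩ := pr_inv hr hp
      exact ⟨r', hr', hlt, (active_Si_iff hr' hs').1 ha, (head_not_iff hr' hs').1 hn⟩
    · rintro ⟨r', hr', hlt, ha, hn⟩
      exact hs _ (.preferred (pr_mem_of_lt hs hr' hr hlt) ((active_Si_iff hr' hs').2 ha)
        ((head_not_iff hr' hs').2 hn))
  have pref_S0_iff : ∀ {r}, r ∈ P.rules →
      (g1 .preferred_generating_rule_exists_S0 (ruleId r) ∈ A ↔
        ∃ r' ∈ P.rules, P.lt r' r ∧ r'.Active S ∅ ∧ ¬ r'.H ⊆ ∅) := by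
    intro r hr
    constructor
    · intro h
      obtain ⟨x, hp, hn⟩ : ∃ x, g2 .pr x (ruleId r) ∈ A ∧ g1 .pos_body_false_S x ∉ A := by
        generalize ruleId r = y at h
        cases step h (by simp) with
        | preferred_S0 hp hn => exact ⟨_, hp, hn⟩
      obtain ⟨r', hr', hlt, rfl⟩ := pr_inv hr hp
      obtain ⟨h, hh⟩ := P.normal r' hr'
      rw [pos_S hr', not_not] at hn
      -- At stage 0 the condition on the negative body is vacuous, and a head, having exactly one
      -- literal, is never contained in `∅`. The stage-0 rule may therefore test the positive body
      -- alone.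
      exact ⟨r', hr', hlt, ⟨hn, Set.inter_empty _⟩, fun hsub => hsub (a := h) (by simp [Rule.H, hh])⟩
    · rintro ⟨r', hr', hlt, ha, -⟩
      exact hs _ (.preferred_S0 (pr_mem_of_lt hs hr' hr hlt) fun h => (pos_S hr').1 h ha.1)
  have T_iff : ∀ {l s}, s ∈ P.rules → (l ∈ T (ruleId s) ↔ l ∈ P.stepW S ∅ ∨
      ∃ s' ∈ P.rules, ruleId s' < ruleId s ∧ l ∈ P.stepW S (T (ruleId s'))) := by
    intro l s hs'
    constructor
    · intro h
      have h' := step h (by simp)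
      have key : (∃ r, g2 .head (litName l) r ∈ A ∧ g1 .active_S0 r ∈ A ∧
          g1 .preferred_generating_rule_exists_S0 r ∉ A) ∨
          ∃ r s', g2 .head (litName l) r ∈ A ∧ g2 .active r s' ∈ A ∧ g1 .stage s' ∈ A ∧
            s' < ruleId s ∧ g2 .preferred_generating_rule_exists r s' ∉ A := by
        generalize litName l = x, ruleId s = y at h'
        cases h' with
        | in_Si h ha h' _ hlt hn => exact .inr ⟨_, _, h, ha, h', hlt, hn⟩
        | in_Si_S0 h ha _ hn => exact .inl ⟨_, h, ha, hn⟩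
      rcases key with ⟨y, hh, ha, hn⟩ | ⟨y, z, hh, ha, hz, hlt, hn⟩
      · obtain ⟨r, hr, l', hl', he, rfl⟩ := head_inv' hh
        obtain rfl := hlit he
        exact .inl ⟨r, hr, hl', (active_S0_iff hr).1 ha, fun h => hn ((pref_S0_iff hr).2 h)⟩
      · obtain ⟨r, hr, l', hl', he, rfl⟩ := head_inv' hh
        obtain rfl := hlit he
        obtain ⟨s', hs'', rfl⟩ := stage_inv hz
        exact .inr ⟨s', hs'', hlt, r, hr, hl', (active_iff hr hs'').1 ha,
          fun h => hn ((pref_iff hr hs'').2 h)⟩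
    · rintro (⟨r, hr, hl, ha, hn⟩ | ⟨s', hs'', hlt, r, hr, hl, ha, hn⟩)
      · exact hs _ (.in_Si_S0 (hs _ (.head hr hl)) ((active_S0_iff hr).2 ha) (stage_of hs')
          fun h => hn ((pref_S0_iff hr).1 h))
      · exact hs _ (.in_Si (hs _ (.head hr hl)) ((active_iff hr hs'').2 ha) (stage_of hs'')
          (stage_of hs') hlt fun h => hn ((pref_iff hr hs'').1 h))
  have T_eq : ∀ {s}, s ∈ P.rules →
      T (ruleId s) = P.seqW S (stageIndex P ruleId (ruleId s)) := by
    intro s hs'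
    -- `T_iff` refers only to strictly smaller identifiers, so `T` and `P.seqW S` satisfy the same
    -- well-founded recursion.
    induction hn : stageIndex P ruleId (ruleId s) using Nat.strong_induction_on
      generalizing s with
    | _ n ih =>
      subst hn
      ext l
      rw [T_iff hs', mem_seqW_stageIndex_iff hid hs']
      refine or_congr_right (exists_congr fun s' => and_congr_right fun hs'' =>
        and_congr_right fun hlt => ?_)
      rw [ih _ ((stageIndex_lt_iff hs').2 hlt) hs'' rfl]
  have PAS_eq : projPAS litName A = P.seqW S P.rules.card := by
    ext l
    rw [mem_seqW_card_iff hid]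
    constructor
    · intro h
      obtain ⟨y, hy⟩ : ∃ y, g2 .in_Si (litName l) y ∈ A := by
        have h' := step (l := g1 .in_PAS (litName l)) h (by simp)
        generalize litName l = x at h'
        cases h' with
        | in_PAS h => exact ⟨_, h⟩
      obtain ⟨s, hs', rfl⟩ : ∃ s ∈ P.rules, ruleId s = y := by
        have h' := step hy (by simp)
        generalize litName l = x at h'
        cases h' with
        | in_Si _ _ _ h => exact stage_inv h
        | in_Si_S0 _ _ h => exact stage_inv h
      exact ⟨s, hs', T_eq hs' ▸ hy⟩
    · rintro ⟨s, hs', h⟩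
      rw [← T_eq hs'] at h
      exact hs _ (.in_PAS h)
  have PAS_eq_S : projPAS litName A = S := by
    ext l
    exact ⟨fun h => hg.in_S_of_in_PAS _ h, fun h => hg.in_PAS_of_in_S _ h⟩
  have hcons : Consistent S := by
    rw [Consistent, Set.eq_empty_iff_forall_notMem]
    rintro _ ⟨h, l, hl, rfl⟩
    -- A `compl` fact lists the positive literal first and exists only if both literals occur in
    -- `P`; `S_lits` guarantees the latter.
    cases l with
    | pos a => exact hg.compl _ _ (hs _ (.compl (S_lits hl) (S_lits h))) hl h
    | neg a => exact hg.compl _ _ (hs _ (.compl (S_lits h) (S_lits hl))) h hl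
  rw [PAS_eq_S] at PAS_eq ⊢
  refine ⟨S_lits.trans lits_subset_base, hcons, ?_⟩
  rw [PrioritizedProgram.CW, ← PAS_eq, if_pos hcons]

end Soundness

/-! ### Completeness: the explicit answer set of a W-preferred answer set -/

section Completeness

variable {α C : Type*} [LinearOrder C]

/-- The intended extensions of the predicates of the meta-interpreter for the guess `S`. -/
def MetaModel (litName : Literal α → C) (ruleId : Rule α → C) (P : PrioritizedProgram α)
    (S : Set (Literal α)) : MetaPred → List C → Prop
  | .rule, [x] => ∃ r ∈ P.rules, ruleId r = x
  | .head, [x, y] => ∃ r ∈ P.rules, ∃ l ∈ r.H, litName l = x ∧ ruleId r = y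
  | .pbl, [x, y] => ∃ r ∈ P.rules, ∃ l ∈ r.Bpos, litName l = x ∧ ruleId r = y
  | .nbl, [x, y] => ∃ r ∈ P.rules, ∃ l ∈ r.Bneg, litName l = x ∧ ruleId r = y
  | .compl, [x, y] => ∃ a, Literal.pos a ∈ P.lits ∧ Literal.neg a ∈ P.lits ∧
      litName (.pos a) = x ∧ litName (.neg a) = y
  | .pr, [x, y] => ∃ r ∈ P.rules, ∃ r' ∈ P.rules, P.lt r r' ∧ ruleId r = x ∧ ruleId r' = y
  | .lit, [x] => ∃ l ∈ P.lits, litName l = x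
  | .in_S, [x] => ∃ l ∈ P.lits, litName l = x ∧ l ∈ S
  | .notin_S, [x] => ∃ l ∈ P.lits, litName l = x ∧ l ∉ S
  | .stage, [x] => ∃ r ∈ P.rules, ruleId r = x
  | .pos_body_false_S, [x] => ∃ r ∈ P.rules, ruleId r = x ∧ ¬ r.Bpos ⊆ S
  | .pos_body_false_Si, [x, y] => ∃ r ∈ P.rules, ∃ s ∈ P.rules, ruleId r = x ∧ ruleId s = y ∧
      ¬ r.Bpos ⊆ P.seqW S (stageIndex P ruleId y)
  | .pos_body_false_S0, [x] => ∃ r ∈ P.rules, ruleId r = x ∧ ¬ r.Bpos ⊆ ∅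
  | .neg_body_false_S, [x] => ∃ r ∈ P.rules, ruleId r = x ∧ ¬ r.Bneg ∩ S = ∅
  | .neg_body_false_Si, [x, y] => ∃ r ∈ P.rules, ∃ s ∈ P.rules, ruleId r = x ∧ ruleId s = y ∧
      ¬ r.Bneg ∩ P.seqW S (stageIndex P ruleId y) = ∅
  | .active, [x, y] => ∃ r ∈ P.rules, ∃ s ∈ P.rules, ruleId r = x ∧ ruleId s = y ∧
      r.Active (P.seqW S (stageIndex P ruleId y)) S
  | .active_Si, [x, y] => ∃ r ∈ P.rules, ∃ s ∈ P.rules, ruleId r = x ∧ ruleId s = y ∧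
      r.Active S (P.seqW S (stageIndex P ruleId y))
  | .active_S0, [x] => ∃ r ∈ P.rules, ruleId r = x ∧ r.Active ∅ S
  | .head_not_in_Si, [x, y] => ∃ r ∈ P.rules, ∃ s ∈ P.rules, ruleId r = x ∧ ruleId s = y ∧
      ¬ r.H ⊆ P.seqW S (stageIndex P ruleId y)
  | .preferred_generating_rule_exists, [x, y] =>
      ∃ r ∈ P.rules, ∃ s ∈ P.rules, ruleId r = x ∧ ruleId s = y ∧
        ∃ r' ∈ P.rules, P.lt r' r ∧ r'.Active S (P.seqW S (stageIndex P ruleId y)) ∧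
          ¬ r'.H ⊆ P.seqW S (stageIndex P ruleId y)
  | .preferred_generating_rule_exists_S0, [x] => ∃ r ∈ P.rules, ruleId r = x ∧
      ∃ r' ∈ P.rules, P.lt r' r ∧ r'.Active S ∅ ∧ ¬ r'.H ⊆ ∅
  | .in_Si, [x, y] => ∃ l, ∃ s ∈ P.rules, litName l = x ∧ ruleId s = y ∧
      l ∈ P.seqW S (stageIndex P ruleId y)
  | .in_PAS, [x] => ∃ l ∈ P.seqW S P.rules.card, litName l = x
  | _, _ => False

/-- The intended answer set for the guess `S`. -/
def metaModelSet (litName : Literal α → C) (ruleId : Rule α → C) (P : PrioritizedProgram α)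
    (S : Set (Literal α)) : Set (Literal (Atom MetaPred C)) :=
  {l | ∃ a, l = .pos a ∧ MetaModel litName ruleId P S a.pred a.args}

variable {litName : Literal α → C} {ruleId : Rule α → C} {P : PrioritizedProgram α}
  {S : Set (Literal α)}

@[simp]
theorem pos_mem_metaModelSet {p : MetaPred} {args : List C} :
    Literal.pos ⟨p, args⟩ ∈ metaModelSet litName ruleId P S ↔
      MetaModel litName ruleId P S p args := by
  simp [metaModelSet]

/-- Closure under the derivation rules holds for every guess `S`; that `S` is a consistent fixed
point matters only for the constraints. -/
theorem metaStep_metaModelSet (hlit : Function.Injective litName)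
    (hid : Set.InjOn ruleId {r | r ∈ P.rules}) (l : Literal (Atom MetaPred C))
    (h : MetaStep litName ruleId P (metaModelSet litName ruleId P S)
      (metaModelSet litName ruleId P S) l) : l ∈ metaModelSet litName ruleId P S := by
  cases h <;> simp only [pos_mem_metaModelSet, MetaModel] at *
  case rule hr => exact ⟨_, hr, rfl⟩
  case head hr hl => exact ⟨_, hr, _, hl, rfl, rfl⟩
  case pbl hr hl => exact ⟨_, hr, _, hl, rfl, rfl⟩
  case nbl hr hl => exact ⟨_, hr, _, hl, rfl, rfl⟩
  case compl h h' => exact ⟨_, h, h', rfl, rfl⟩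
  case pr hr hr' hlt _ => exact ⟨_, hr, _, hr', hlt, rfl, rfl⟩
  case lit_head h =>
    obtain ⟨r, hr, l, hl, rfl, -⟩ := h
    exact ⟨l, ⟨r, hr, .inl (.inl hl)⟩, rfl⟩
  case lit_pbl h =>
    obtain ⟨r, hr, l, hl, rfl, -⟩ := h
    exact ⟨l, ⟨r, hr, .inl (.inr hl)⟩, rfl⟩
  case lit_nbl h =>
    obtain ⟨r, hr, l, hl, rfl, -⟩ := h
    exact ⟨l, ⟨r, hr, .inr hl⟩, rfl⟩
  case pr_trans h h' =>
    obtain ⟨r, hr, r', hr', hlt, rfl, rfl⟩ := h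
    obtain ⟨s, hs, s', hs', hlt', he, rfl⟩ := h'
    obtain rfl := hid hs hr' he
    exact ⟨r, hr, s', hs', P.trans _ hr _ hr' _ hs' hlt hlt', rfl, rfl⟩
  case stage h => exact h
  case pos_body_false_S h hp hn =>
    obtain ⟨r, hr, l, hl, rfl, rfl⟩ := hp
    exact ⟨r, hr, rfl, fun hsub => hn ⟨l, ⟨r, hr, .inl (.inr hl)⟩, rfl, hsub hl⟩⟩
  case pos_body_false_Si hp hs hn =>
    obtain ⟨r, hr, l, hl, rfl, rfl⟩ := hp
    obtain ⟨s, hs', rfl⟩ := hs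
    exact ⟨r, hr, s, hs', rfl, rfl, fun hsub => hn ⟨l, s, hs', rfl, rfl, hsub hl⟩⟩
  case pos_body_false_S0 hp =>
    obtain ⟨r, hr, l, hl, rfl, rfl⟩ := hp
    exact ⟨r, hr, rfl, fun hsub => hsub hl⟩
  case neg_body_false_S h hp hn =>
    obtain ⟨r, hr, l, hl, rfl, rfl⟩ := hp
    obtain ⟨l', hl', he, hS⟩ := hn
    obtain rfl := hlit he
    exact ⟨r, hr, rfl, not_disjoint_iff.2 ⟨_, hl, hS⟩⟩
  case neg_body_false_Si hp hs hn =>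
    obtain ⟨r, hr, l, hl, rfl, rfl⟩ := hp
    obtain ⟨l', s, hs', he, rfl, hS⟩ := hn
    obtain rfl := hlit he
    exact ⟨r, hr, s, hs', rfl, rfl, not_disjoint_iff.2 ⟨_, hl, hS⟩⟩
  case active h hs h₁ h₂ =>
    obtain ⟨r, hr, rfl⟩ := h
    obtain ⟨s, hs, rfl⟩ := hs
    exact ⟨r, hr, s, hs, rfl, rfl, by_contra fun h => h₁ ⟨r, hr, s, hs, rfl, rfl, h⟩,
      by_contra fun h => h₂ ⟨r, hr, rfl, h⟩⟩
  case active_Si h hs h₁ h₂ =>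
    obtain ⟨r, hr, rfl⟩ := h
    obtain ⟨s, hs, rfl⟩ := hs
    exact ⟨r, hr, s, hs, rfl, rfl, by_contra fun h => h₁ ⟨r, hr, rfl, h⟩,
      by_contra fun h => h₂ ⟨r, hr, s, hs, rfl, rfl, h⟩⟩
  case active_S0 h h₁ h₂ =>
    obtain ⟨r, hr, rfl⟩ := h
    exact ⟨r, hr, rfl, by_contra fun h => h₁ ⟨r, hr, rfl, h⟩,
      by_contra fun h => h₂ ⟨r, hr, rfl, h⟩⟩
  case head_not_in_Si hs hp hn =>
    obtain ⟨r, hr, l, hl, rfl, rfl⟩ := hp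
    obtain ⟨s, hs, rfl⟩ := hs
    exact ⟨r, hr, s, hs, rfl, rfl, fun hsub => hn ⟨l, s, hs, rfl, rfl, hsub hl⟩⟩
  case preferred hp ha hn =>
    obtain ⟨r', hr', r, hr, hlt, rfl, rfl⟩ := hp
    obtain ⟨t, ht, s, hs, he, rfl, ha⟩ := ha
    obtain ⟨t', ht', -, -, he', -, hn⟩ := hn
    obtain rfl := hid ht hr' he
    obtain rfl := hid ht' ht he'
    exact ⟨r, hr, s, hs, rfl, rfl, _, ht, hlt, ha, hn⟩
  case preferred_S0 hp hn =>
    obtain ⟨r', hr', r, hr, hlt, rfl, rfl⟩ := hp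
    -- The existence of a head literal supplies the condition `¬ r'.H ⊆ ∅`, which the stage-0 rule
    -- does not test.
    obtain ⟨h, hh⟩ := P.normal r' hr'
    exact ⟨r, hr, rfl, r', hr', hlt,
      ⟨by_contra fun h => hn ⟨r', hr', rfl, h⟩, Set.inter_empty _⟩,
      fun hsub => hsub (a := h) (by simp [Rule.H, hh])⟩
  case in_Si hlt hh ha hs' hs hn =>
    obtain ⟨r, hr, l, hl, rfl, rfl⟩ := hh
    obtain ⟨t, ht, s', hs'', he, rfl, ha⟩ := ha
    obtain ⟨s, hs, rfl⟩ := hs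
    obtain rfl := hid ht hr he
    exact ⟨l, s, hs, rfl, rfl, (mem_seqW_stageIndex_iff hid hs).2
      (.inr ⟨s', hs'', hlt, t, ht, hl, ha, fun h => hn ⟨t, ht, s', hs'', rfl, rfl, h⟩⟩)⟩
  case in_Si_S0 hh ha hs hn =>
    obtain ⟨r, hr, l, hl, rfl, rfl⟩ := hh
    obtain ⟨t, ht, he, ha⟩ := ha
    obtain ⟨s, hs, rfl⟩ := hs
    obtain rfl := hid ht hr he
    exact ⟨l, s, hs, rfl, rfl, (mem_seqW_stageIndex_iff hid hs).2
      (.inl ⟨t, ht, hl, ha, fun h => hn ⟨t, ht, rfl, h⟩⟩)⟩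
  case in_PAS h =>
    obtain ⟨l, s, hs, rfl, rfl, h⟩ := h
    exact ⟨l, (mem_seqW_card_iff hid).2 ⟨s, hs, h⟩, rfl⟩

/-- Consistency of `S` serves the `compl` constraint, irreflexivity of the order the one on `pr`,
and `Sₙ = S` the two comparing `in_PAS` with `in_S`. -/
theorem metaGuess_metaModelSet (hlit : Function.Injective litName)
    (hid : Set.InjOn ruleId {r | r ∈ P.rules}) (hcons : Consistent S)
    (hS : P.seqW S P.rules.card = S) :
    MetaGuess (metaModelSet litName ruleId P S) (metaModelSet litName ruleId P S) := by
  constructor <;> simp only [pos_mem_metaModelSet, MetaModel]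
  · rintro _ ⟨l, hl, rfl⟩
    by_cases h : l ∈ S
    · exact .inl ⟨l, hl, rfl, h⟩
    · exact .inr ⟨l, hl, rfl, h⟩
  · rintro _ _ ⟨a, -, -, rfl, rfl⟩ ⟨l, -, he, h⟩ ⟨l', -, he', h'⟩
    obtain rfl := hlit he
    obtain rfl := hlit he'
    exact Set.eq_empty_iff_forall_notMem.1 hcons _ ⟨h', _, h, rfl⟩
  · rintro _ ⟨r, hr, r', hr', hlt, rfl, he⟩
    obtain rfl := hid hr' hr he
    exact P.irrefl _ hr hlt
  · rintro _ ⟨l, hl, rfl⟩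
    exact ⟨l, seqW_subset_lits hl, rfl, hS ▸ hl⟩
  · rintro _ ⟨l, -, rfl, hl⟩
    exact ⟨l, hS.symm ▸ hl, rfl⟩

/-- This is the minimality of the model. Default negation stays evaluated in the full model, so only
positive premises have to be rederived in `J`. -/
theorem metaModelSet_subset_of_closed (hid : Set.InjOn ruleId {r | r ∈ P.rules})
    (hlit : Function.Injective litName)
    {J : Set (Literal (Atom MetaPred C))} (hJ : J ⊆ metaModelSet litName ruleId P S)
    (hs : ∀ l, MetaStep litName ruleId P (metaModelSet litName ruleId P S) J l → l ∈ J)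
    (hg : ∀ x, g1 .lit x ∈ J → g1 .in_S x ∈ J ∨ g1 .notin_S x ∈ J) :
    metaModelSet litName ruleId P S ⊆ J := by
  have rule_of : ∀ {r}, r ∈ P.rules → g1 .rule (ruleId r) ∈ J := fun hr => hs _ (.rule hr)
  have stage_of : ∀ {r}, r ∈ P.rules → g1 .stage (ruleId r) ∈ J := fun hr =>
    hs _ (.stage (rule_of hr))
  have pos_of : ∀ {r l}, r ∈ P.rules → l ∈ r.Bpos → g2 .pbl (litName l) (ruleId r) ∈ J :=
    fun hr hl => hs _ (.pbl hr hl)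
  have neg_of : ∀ {r l}, r ∈ P.rules → l ∈ r.Bneg → g2 .nbl (litName l) (ruleId r) ∈ J :=
    fun hr hl => hs _ (.nbl hr hl)
  have head_of : ∀ {r l}, r ∈ P.rules → l ∈ r.H → g2 .head (litName l) (ruleId r) ∈ J :=
    fun hr hl => hs _ (.head hr hl)
  have lit_of : ∀ {l}, l ∈ P.lits → g1 .lit (litName l) ∈ J := by
    rintro l ⟨r, hr, (hl | hl) | hl⟩
    · exact hs _ (.lit_head (head_of hr hl))
    · exact hs _ (.lit_pbl (pos_of hr hl))
    · exact hs _ (.lit_nbl (neg_of hr hl))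
  have in_S_of : ∀ {l}, l ∈ P.lits → l ∈ S → g1 .in_S (litName l) ∈ J := by
    intro l hl h
    -- `J` must choose one disjunct, and the model containing `J` lacks the wrong one.
    refine (hg _ (lit_of hl)).resolve_right fun h' => ?_
    have := hJ h'
    simp only [pos_mem_metaModelSet, MetaModel] at this
    obtain ⟨l', -, he, hn⟩ := this
    exact hn (hlit he ▸ h)
  have notin_S_of : ∀ {l}, l ∈ P.lits → l ∉ S → g1 .notin_S (litName l) ∈ J := by
    intro l hl h
    refine (hg _ (lit_of hl)).resolve_left fun h' => ?_
    have := hJ h'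
    simp only [pos_mem_metaModelSet, MetaModel] at this
    obtain ⟨l', -, he, hn⟩ := this
    exact h (hlit he ▸ hn)
  have active_of : ∀ {r s}, r ∈ P.rules → s ∈ P.rules →
      r.Active (P.seqW S (stageIndex P ruleId (ruleId s))) S →
      g2 .active (ruleId r) (ruleId s) ∈ J := by
    intro r s hr hs' ha
    refine hs _ (.active (rule_of hr) (stage_of hs') ?_ ?_) <;>
      simp only [pos_mem_metaModelSet, MetaModel]
    · rintro ⟨r', hr', s', -, he, he', hn⟩
      exact hn (hid hr' hr he ▸ ha.1)
    · rintro ⟨r', hr', he, hn⟩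
      exact hn (hid hr' hr he ▸ ha.2)
  have active_Si_of : ∀ {r s}, r ∈ P.rules → s ∈ P.rules →
      r.Active S (P.seqW S (stageIndex P ruleId (ruleId s))) →
      g2 .active_Si (ruleId r) (ruleId s) ∈ J := by
    intro r s hr hs' ha
    refine hs _ (.active_Si (rule_of hr) (stage_of hs') ?_ ?_) <;>
      simp only [pos_mem_metaModelSet, MetaModel]
    · rintro ⟨r', hr', he, hn⟩
      exact hn (hid hr' hr he ▸ ha.1)
    · rintro ⟨r', hr', s', -, he, he', hn⟩
      exact hn (hid hr' hr he ▸ ha.2)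
  have active_S0_of : ∀ {r}, r ∈ P.rules → r.Active ∅ S → g1 .active_S0 (ruleId r) ∈ J := by
    intro r hr ha
    refine hs _ (.active_S0 (rule_of hr) ?_ ?_) <;>
      simp only [pos_mem_metaModelSet, MetaModel]
    · rintro ⟨r', hr', he, hn⟩
      exact hn (hid hr' hr he ▸ ha.1)
    · rintro ⟨r', hr', he, hn⟩
      exact hn (hid hr' hr he ▸ ha.2)
  have not_in_Si : ∀ {l c}, l ∉ P.seqW S (stageIndex P ruleId c) →
      g2 .in_Si (litName l) c ∉ metaModelSet litName ruleId P S := by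
    intro l c hl
    simp only [pos_mem_metaModelSet, MetaModel]
    rintro ⟨l', s, -, he, -, h⟩
    exact hl (hlit he ▸ h)
  have not_in_S : ∀ {l}, l ∉ S → g1 .in_S (litName l) ∉ metaModelSet litName ruleId P S := by
    intro l hl
    simp only [pos_mem_metaModelSet, MetaModel]
    rintro ⟨l', -, he, h⟩
    exact hl (hlit he ▸ h)
  have not_pos_S : ∀ {r}, r ∈ P.rules → r.Bpos ⊆ S →
      g1 .pos_body_false_S (ruleId r) ∉ metaModelSet litName ruleId P S := by
    intro r hr h
    simp only [pos_mem_metaModelSet, MetaModel]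
    rintro ⟨r', hr', he, hn⟩
    exact hn (hid hr' hr he ▸ h)
  have head_not_of : ∀ {r s}, r ∈ P.rules → s ∈ P.rules →
      ¬ r.H ⊆ P.seqW S (stageIndex P ruleId (ruleId s)) →
      g2 .head_not_in_Si (ruleId r) (ruleId s) ∈ J := by
    intro r s hr hs' h
    obtain ⟨l, hl, hn⟩ := Set.not_subset.1 h
    exact hs _ (.head_not_in_Si (stage_of hs') (head_of hr hl) (not_in_Si hn))
  -- No induction over stages is needed: the positive premises of `active` and `active_S0` are only
  -- `rule` and `stage` atoms, and earlier stages enter only through negated atoms.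
  have in_Si_of : ∀ {l s}, s ∈ P.rules → l ∈ P.seqW S (stageIndex P ruleId (ruleId s)) →
      g2 .in_Si (litName l) (ruleId s) ∈ J := by
    intro l s hs' h
    rcases (mem_seqW_stageIndex_iff hid hs').1 h with
      ⟨r, hr, hl, ha, hn⟩ | ⟨s', hs'', hlt, r, hr, hl, ha, hn⟩
    · refine hs _ (.in_Si_S0 (head_of hr hl) (active_S0_of hr ha) (stage_of hs') ?_)
      simp only [pos_mem_metaModelSet, MetaModel]
      rintro ⟨r', hr', he, h⟩
      exact hn (hid hr' hr he ▸ h)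
    · refine hs _ (.in_Si (head_of hr hl) (active_of hr hs'' ha) (stage_of hs'') (stage_of hs')
        hlt ?_)
      simp only [pos_mem_metaModelSet, MetaModel]
      rintro ⟨r', hr', _, -, he, -, h⟩
      exact hn (hid hr' hr he ▸ h)
  rintro _ ⟨⟨p, args⟩, rfl, h⟩
  change MetaModel litName ruleId P S p args at h
  unfold MetaModel at h
  split at h
  · obtain ⟨r, hr, rfl⟩ := h
    exact rule_of hr
  · obtain ⟨r, hr, l, hl, rfl, rfl⟩ := h
    exact head_of hr hl
  · obtain ⟨r, hr, l, hl, rfl, rfl⟩ := h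
    exact pos_of hr hl
  · obtain ⟨r, hr, l, hl, rfl, rfl⟩ := h
    exact neg_of hr hl
  · obtain ⟨a, ha, ha', rfl, rfl⟩ := h
    exact hs _ (.compl ha ha')
  · obtain ⟨r, hr, r', hr', hlt, rfl, rfl⟩ := h
    exact pr_mem_of_lt hs hr hr' hlt
  · obtain ⟨l, hl, rfl⟩ := h
    exact lit_of hl
  · obtain ⟨l, hl, rfl, h⟩ := h
    exact in_S_of hl h
  · obtain ⟨l, hl, rfl, h⟩ := h
    exact notin_S_of hl h
  · obtain ⟨r, hr, rfl⟩ := h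
    exact stage_of hr
  · obtain ⟨r, hr, rfl, h⟩ := h
    obtain ⟨l, hl, hn⟩ := Set.not_subset.1 h
    exact hs _ (.pos_body_false_S (rule_of hr) (pos_of hr hl) (not_in_S hn))
  · obtain ⟨r, hr, s, hs', rfl, rfl, h⟩ := h
    obtain ⟨l, hl, hn⟩ := Set.not_subset.1 h
    exact hs _ (.pos_body_false_Si (pos_of hr hl) (stage_of hs') (not_in_Si hn))
  · obtain ⟨r, hr, rfl, h⟩ := h
    obtain ⟨l, hl, hn⟩ := Set.not_subset.1 h
    exact hs _ (.pos_body_false_S0 (pos_of hr hl))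
  · obtain ⟨r, hr, rfl, h⟩ := h
    obtain ⟨l, hl, h⟩ := not_disjoint_iff.1 h
    exact hs _ (.neg_body_false_S (rule_of hr) (neg_of hr hl) (in_S_of ⟨r, hr, .inr hl⟩ h))
  · obtain ⟨r, hr, s, hs', rfl, rfl, h⟩ := h
    obtain ⟨l, hl, h⟩ := not_disjoint_iff.1 h
    exact hs _ (.neg_body_false_Si (neg_of hr hl) (stage_of hs') (in_Si_of hs' h))
  · obtain ⟨r, hr, s, hs', rfl, rfl, h⟩ := h
    exact active_of hr hs' h
  · obtain ⟨r, hr, s, hs', rfl, rfl, h⟩ := h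
    exact active_Si_of hr hs' h
  · obtain ⟨r, hr, rfl, h⟩ := h
    exact active_S0_of hr h
  · obtain ⟨r, hr, s, hs', rfl, rfl, h⟩ := h
    exact head_not_of hr hs' h
  · obtain ⟨r, hr, s, hs', rfl, rfl, r', hr', hlt, ha, hn⟩ := h
    exact hs _ (.preferred (pr_mem_of_lt hs hr' hr hlt) (active_Si_of hr' hs' ha)
      (head_not_of hr' hs' hn))
  · obtain ⟨r, hr, rfl, r', hr', hlt, ha, -⟩ := h
    exact hs _ (.preferred_S0 (pr_mem_of_lt hs hr' hr hlt) (not_pos_S hr' ha.1))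
  · obtain ⟨l, s, hs', rfl, rfl, h⟩ := h
    exact in_Si_of hs' h
  · obtain ⟨l, hl, rfl⟩ := h
    obtain ⟨s, hs', h⟩ := (mem_seqW_card_iff hid).1 hl
    exact hs _ (.in_PAS (in_Si_of hs' h))
  · exact h.elim

variable [Inhabited C]

theorem metaModelSet_subset_herbrandBase :
    metaModelSet litName ruleId P S ⊆ herbrandBase (metaW C ∪ facts litName ruleId P) := by
  rintro _ ⟨⟨p, args⟩, rfl, h⟩
  change MetaModel litName ruleId P S p args at h
  constructor
  -- Every predicate with its arity already occurs in the rules of the interpreter, so a finite list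
  -- of name-arity pairs suffices.
  · suffices h' : (p, args.length) ∈ (metaRules C).flatMap fun r =>
        (r.head ++ r.pos ++ r.neg).map fun l => (l.atom.pred, l.atom.args.length) by
      obtain ⟨r, hr, h'⟩ := List.mem_flatMap.1 h'
      obtain ⟨l, hl, h'⟩ := List.mem_map.1 h'
      exact ⟨r, .inl hr, l.atom, ⟨l, hl, rfl⟩, (Prod.ext_iff.1 h').1, (Prod.ext_iff.1 h').2⟩
    simp only [metaRules, a1, a2, Literal.atom, List.flatMap_cons, List.flatMap_nil,
      List.map_cons, List.map_nil, List.cons_append, List.nil_append, List.append_nil,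
      List.length_cons, List.length_nil]
    unfold MetaModel at h
    split at h
    all_goals first
      | exact h.elim
      | simp
  · intro c hc
    change c ∈ args at hc
    suffices h' : (∃ r ∈ P.rules, ruleId r = c) ∨ ∃ l ∈ P.lits, litName l = c by
      rcases h' with ⟨r, hr, rfl⟩ | ⟨l, hl, rfl⟩
      · exact ruleId_mem_universe hr
      · exact litName_mem_universe hl
    have hH : ∀ r ∈ P.rules, ∀ l ∈ r.H, l ∈ P.lits := fun r hr l hl => ⟨r, hr, .inl (.inl hl)⟩
    have hp : ∀ r ∈ P.rules, ∀ l ∈ r.Bpos, l ∈ P.lits := fun r hr l hl => ⟨r, hr, .inl (.inr hl)⟩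
    have hn : ∀ r ∈ P.rules, ∀ l ∈ r.Bneg, l ∈ P.lits := fun r hr l hl => ⟨r, hr, .inr hl⟩
    have hs : ∀ i, ∀ l ∈ P.seqW S i, l ∈ P.lits := fun i l hl => seqW_subset_lits hl
    unfold MetaModel at h
    split at h
    all_goals first
      | exact h.elim
      | simp only [List.mem_cons, List.not_mem_nil, or_false] at hc
        grind

theorem exists_answerSet_of_mem_WPAS (hlit : Function.Injective litName)
    (hid : Set.InjOn ruleId {r | r ∈ P.rules}) (hS : S ∈ P.WPAS) :
    ∃ A ∈ answerSets (metaW C ∪ facts litName ruleId P), projPAS litName A = S := by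
  obtain ⟨-, hcons, hCW⟩ := hS
  have hseq : P.seqW S P.rules.card = S := by
    rw [PrioritizedProgram.CW] at hCW
    split at hCW
    · exact hCW
    · next hn =>
      -- Otherwise `S` would be the whole base and would contain `Sₙ`, making `Sₙ` consistent after
      -- all.
      refine absurd ?_ hn
      have hsub : P.seqW S P.rules.card ⊆ S :=
        (seqW_subset_lits.trans lits_subset_base).trans hCW.subset
      exact Set.subset_eq_empty (Set.inter_subset_inter hsub (Set.image_mono hsub)) hcons
  have hB := metaModelSet_subset_herbrandBase (litName := litName) (ruleId := ruleId) (P := P)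
    (S := S)
  refine ⟨metaModelSet litName ruleId P S, ⟨⟨hB, ?_, ?_⟩, ?_⟩, ?_⟩
  -- The model contains only positive literals.
  · rw [Consistent, Set.eq_empty_iff_forall_notMem]
    rintro _ ⟨⟨a, rfl, -⟩, _, ⟨b, rfl, -⟩, h⟩
    cases h
  · exact (closedUnder_reduct_meta_iff hB).2 
      ⟨metaStep_metaModelSet hlit hid,
        metaGuess_metaModelSet hlit hid hcons hseq⟩
  · rintro J ⟨hJB, -, hJ⟩ hsub
    obtain ⟨hs, hg⟩ := (closedUnder_reduct_meta_iff hJB).1 hJ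
    exact metaModelSet_subset_of_closed hid hlit hsub hs hg.guess
  · ext l
    simp only [projPAS, Set.mem_ofPred_eq, pos_mem_metaModelSet, MetaModel, hseq]
    exact ⟨fun ⟨l', h, he⟩ => hlit he ▸ h, fun h => ⟨l, h, rfl⟩⟩

end Completeness

end ASP

theorem theorem4 {α C : Type*} [Inhabited C] [LinearOrder C]
    (litName : ASP.Literal α → C) (hlit : Function.Injective litName)
    (P : ASP.PrioritizedProgram α)
    (ruleId : ASP.Rule α → C) (hid : Set.InjOn ruleId {r | r ∈ P.rules}) :
    (∀ A ∈ ASP.answerSets (ASP.metaW C ∪ ASP.facts litName ruleId P),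
      ASP.projPAS litName A ∈ P.WPAS) ∧
    (∀ A ∈ P.WPAS, ∃ A' ∈ ASP.answerSets (ASP.metaW C ∪ ASP.facts litName ruleId P),
      ASP.projPAS litName A' = A) :=
  ⟨fun _ hA => ASP.projPAS_mem_WPAS hlit hid hA,
    fun _ hA => ASP.exists_answerSet_of_mem_WPAS hlit hid hA⟩
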